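/- Let $d,N\ge 1$ and write $\mathcal M_d$ for the complex $d\times d$ matrices. A quantum channel is a completely positive trace-preserving linear map. For a channel $\Phi:\mathcal M_d\to\mathcal M_d^{\otimes N}$ let $\Phi_i(X)$ be the partial trace of $\Phi(X)$ over all output systems except the $i$-th. Let $F(\rho,\sigma)=\big(\operatorname{Tr}\sqrt{\sqrt\sigma\rho\sqrt\sigma}\big)^2$ be the fidelity, and let $\mathbb E_\rho$ be the expectation over the uniform (unitarily invariant) probability measure on all pure states $\rho$ of $\mathbb C^d$. Let $|\Omega\rangle=\frac1{\sqrt d}\sum_{i}|ii\rangle$ and $\omega=|\Omega\rangle\langle\Omega|$. On $(\mathbb C^d)^{\otimes(N+1)}$, with systems numbered $0,1,\dots,N$, a subscript $(0,i)$ means that an object acts on systems $0$ and $i$. Let $a\in[0,1]^N$ with $\sum_i a_i=1$ (a direction vector), and put $$S_a=\sum_{i=1}^N a_i\, d\,\omega_{(0,i)}\otimes I_d^{\otimes(N-1)},\qquad R_a=\sum_{i=1}^N a_i\big(I_{d^2}+d\,\omega\big)_{(0,i)}\otimes I_d^{\otimes(N-1)}.$$ Let $\psi(\sigma)(v_0\otimes\dots\otimes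 v_{N-1})=v_{\sigma^{-1}(0)}\otimes\dots\otimes v_{\sigma^{-1}(N-1)}$ for $\sigma\in\mathfrak S_N$ (the permutations of $\{0,\dots,N-1\}$), let $P^+=\frac1{N!}\sum_{\sigma\in\mathfrak S_N}\psi(\sigma)$, and let $\vee^{N-1}\mathbb C^d=\operatorname{span}\{w^{\otimes(N-1)}:w\in\mathbb C^d\}$. (i) There are real numbers $b_1,\dots,b_N\ge0$ and a unit vector $|v\rangle\in\vee^{N-1}\mathbb C^d$ such that $$\chi=\sum_{i=1}^N b_i\,\big(\sqrt d\,|\Omega\rangle_{(0,i)}\big)\otimes|v\rangle$$ is a unit eigenvector of $S_a$ for its largest eigenvalue. (ii) For all real $b_1,\dots,b_N$ and all unit vectors $|v\rangle\in\vee^{N-1}\mathbb C^d$ such that $\chi$ is a unit eigenvector of $S_a$ for its largest eigenvalue, the linear map $\Phi^a_{\mathrm{opt}}:\mathcal M_d\to\mathcal M_d^{\otimes N}$, $$\Phi^a_{\mathrm{opt}}(\rho)=\frac{d\,N\,(N+d-1)}{\operatorname{Tr}P^+}\;P^a\big(\rho\otimes I_d^{\otimes(N-1)}\big)(P^a)^*,\qquad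 P^a=\frac1{N!}\sum_{\sigma\in\mathfrak S_N}b_{\sigma(0)+1}\,\psi(\sigma),$$ is a quantum channel, $$\sum_{i=1}^N a_i\,\mathbb E_\rho\Big[F\big((\Phi^a_{\mathrm{opt}})_i(\rho),\rho\big)\Big]=\frac{\lambda_{\max}(R_a)}{d+1},$$ and $\sum_i a_i\,\mathbb E_\rho[F(\Psi_i(\rho),\rho)]\le\sum_i a_i\,\mathbb E_\rho[F((\Phi^a_{\mathrm{opt}})_i(\rho),\rho)]$ for every quantum channel $\Psi:\mathcal M_d\to\mathcal M_d^{\otimes N}$; that is, $\Phi^a_{\mathrm{opt}}$ is optimal for asymmetric universal $1\to N$ quantum cloning in the direction $a$. -/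

import Mathlib

/-!  Conventions. `Fin d → ℂ` is `ℂ^d`; the `k`-fold tensor power `(ℂ^d)^{⊗k}` is
`(Fin k → Fin d) → ℂ` in the computational basis, and `(M_d)^{⊗k}` is the matrix algebra on
the index type `Fin k → Fin d`. The number of copies is `N = n + 1`; they are numbered by
`Fin (n + 1)`, starting from `0`. On `N + 1` systems, `0` is the input system and the `i`-th
copy is the system `i.succ`. -/

namespace Cloning

noncomputable section

/-- `k`-fold tensor power of `M_d`. -/
abbrev TensorMat (k d : ℕ) : Type := Matrix (Fin k → Fin d) (Fin k → Fin d) ℂ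

/-- The tensor product `A 0 ⊗ A 1 ⊗ ⋯ ⊗ A (k - 1)` of `d × d` matrices. -/
def tensorMatrix {k d : ℕ} (A : Fin k → Matrix (Fin d) (Fin d) ℂ) : TensorMat k d :=
  Matrix.of fun x y => ∏ l, A l (x l) (y l)

/-- The tensor product `w 0 ⊗ w 1 ⊗ ⋯ ⊗ w (k - 1)` of vectors. -/
def tensorVec {k d : ℕ} (w : Fin k → Fin d → ℂ) : (Fin k → Fin d) → ℂ :=
  fun x => ∏ l, w l (x l)

/-- The tensor representation of the symmetric group,
`ψ(σ) (v_0 ⊗ ⋯ ⊗ v_{k-1}) = v_{σ⁻¹(0)} ⊗ ⋯ ⊗ v_{σ⁻¹(k-1)}`. -/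
def permRep {k d : ℕ} (σ : Equiv.Perm (Fin k)) : TensorMat k d :=
  Matrix.of fun x y => if x = y ∘ σ.symm then 1 else 0

/-- The symmetric subspace `∨^k ℂ^d`, the span of the vectors `w ⊗ ⋯ ⊗ w`. -/
def symmetricSubspace (k d : ℕ) : Submodule ℂ ((Fin k → Fin d) → ℂ) :=
  Submodule.span ℂ (Set.range fun w : Fin d → ℂ => tensorVec fun _ : Fin k => w)

/-- The projector `P⁺ = (1/k!) ∑_σ ψ(σ)` onto the symmetric subspace. -/
def symProjector (k d : ℕ) : TensorMat k d :=
  ((k.factorial : ℂ)⁻¹) • ∑ σ : Equiv.Perm (Fin k), permRep σ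

/-- `P^a = (1/N!) ∑_σ b_{σ(0)} ψ(σ)`, with the copies numbered from `0`. -/
def weightedProjector {n : ℕ} (d : ℕ) (b : Fin (n + 1) → ℝ) : TensorMat (n + 1) d :=
  (((n + 1).factorial : ℂ)⁻¹) •
    ∑ σ : Equiv.Perm (Fin (n + 1)), ((b (σ 0) : ℝ) : ℂ) • permRep σ

/-- `X ↦ X ⊗ I^{⊗ n}`. -/
def padInput (n d : ℕ) (X : Matrix (Fin d) (Fin d) ℂ) : TensorMat (n + 1) d :=
  tensorMatrix (Fin.cons X fun _ => 1)

theorem padInput_apply (n d : ℕ) (X : Matrix (Fin d) (Fin d) ℂ) (x y : Fin (n + 1) → Fin d) :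
    padInput n d X x y
      = X (x 0) (y 0) * ∏ l : Fin n, (1 : Matrix (Fin d) (Fin d) ℂ) (x l.succ) (y l.succ) := by
  simp [padInput, tensorMatrix, Fin.prod_univ_succ]

theorem padInput_add (n d : ℕ) (X Y : Matrix (Fin d) (Fin d) ℂ) :
    padInput n d (X + Y) = padInput n d X + padInput n d Y := by
  ext x y
  simp only [padInput_apply, Matrix.add_apply, add_mul]

theorem padInput_smul (n d : ℕ) (c : ℂ) (X : Matrix (Fin d) (Fin d) ℂ) :
    padInput n d (c • X) = c • padInput n d X := by
  ext x y
  simp only [padInput_apply, Matrix.smul_apply, smul_eq_mul, mul_assoc]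

/-- The linear map `X ↦ (d N (N + d - 1) / Tr P⁺) • P^a (X ⊗ I^{⊗(N-1)}) (P^a)^*`, with
`N = n + 1`, hence `N + d - 1 = n + d`. -/
def optCloner {n : ℕ} (d : ℕ) (b : Fin (n + 1) → ℝ) :
    Matrix (Fin d) (Fin d) ℂ →ₗ[ℂ] TensorMat (n + 1) d where
  toFun X := ((d : ℂ) * ((n : ℂ) + 1) * ((n : ℂ) + d) / (symProjector (n + 1) d).trace) •
    (weightedProjector d b * padInput n d X * (weightedProjector d b).conjTranspose)
  map_add' X Y := by
    rw [padInput_add, Matrix.mul_add, Matrix.add_mul, smul_add]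
  map_smul' c X := by
    rw [padInput_smul, Matrix.mul_smul, Matrix.smul_mul, smul_comm, RingHom.id_apply]

section Channels

open scoped ComplexOrder MatrixOrder

/-- The partial application `Φ ⊗ id_D`. -/
def partialApply {m m' : Type} (Φ : Matrix m m ℂ →ₗ[ℂ] Matrix m' m' ℂ) (D : ℕ)
    (X : Matrix (m × Fin D) (m × Fin D) ℂ) : Matrix (m' × Fin D) (m' × Fin D) ℂ :=
  Matrix.of fun p q => Φ (Matrix.of fun i j => X (i, p.2) (j, q.2)) p.1 q.1

/-- Quantum channels: completely positive trace preserving linear maps. -/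
structure IsQuantumChannel {m m' : Type} [Fintype m] [Fintype m']
    (Φ : Matrix m m ℂ →ₗ[ℂ] Matrix m' m' ℂ) : Prop where
  completelyPositive : ∀ (D : ℕ) (X : Matrix (m × Fin D) (m × Fin D) ℂ),
    X.PosSemidef → (partialApply Φ D X).PosSemidef
  tracePreserving : ∀ X : Matrix m m ℂ, (Φ X).trace = X.trace

/-- The quantum fidelity `F(ρ, σ) = (Tr √(√σ ρ √σ))²`. The trace is that of a positive
semidefinite matrix, hence a real number. -/
def fidelity {d : ℕ} (ρ σ : Matrix (Fin d) (Fin d) ℂ) : ℝ :=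
  ((CFC.sqrt (CFC.sqrt σ * ρ * CFC.sqrt σ)).trace.re) ^ 2

end Channels

/-- The `i`-th marginal: the partial trace over all systems but the `i`-th. -/
def marginal {n d : ℕ} (i : Fin (n + 1)) (M : TensorMat (n + 1) d) :
    Matrix (Fin d) (Fin d) ℂ :=
  Matrix.of fun r s => ∑ z : Fin n → Fin d,
    M (Fin.insertNth (α := fun _ => Fin d) i r z) (Fin.insertNth (α := fun _ => Fin d) i s z)

/-- The pure state `|u⟩⟨u|` of a unit vector `u`. -/
def pureState {d : ℕ} (u : Metric.sphere (0 : EuclideanSpace ℂ (Fin d)) 1) :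
    Matrix (Fin d) (Fin d) ℂ :=
  Matrix.vecMulVec (u : EuclideanSpace ℂ (Fin d)).ofLp
    (star (u : EuclideanSpace ℂ (Fin d)).ofLp)

/-- The expectation of `f` over the uniform measure on the set of all pure states, the image of
the normalized surface measure of the unit sphere of `ℂ^d` under `u ↦ |u⟩⟨u|`. -/
def pureAverage {d : ℕ} (f : Matrix (Fin d) (Fin d) ℂ → ℝ) : ℝ :=
  MeasureTheory.average
    (MeasureTheory.Measure.toSphere
      (MeasureTheory.volume : MeasureTheory.Measure (EuclideanSpace ℂ (Fin d))))
    (fun u => f (pureState u))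

/-- A direction vector: `a ∈ [0,1]^N` with `∑ a_i = 1`. -/
def IsDirectionVector {n : ℕ} (a : Fin (n + 1) → ℝ) : Prop :=
  (∀ i, a i ∈ Set.Icc (0 : ℝ) 1) ∧ ∑ i, a i = 1

/-- The figure of merit `∑ a_i E_ρ[F(Φ_i(ρ), ρ)]` of the universal cloning problem. -/
def performance {n d : ℕ} (a : Fin (n + 1) → ℝ)
    (Φ : Matrix (Fin d) (Fin d) ℂ →ₗ[ℂ] TensorMat (n + 1) d) : ℝ :=
  ∑ i, a i * pureAverage fun ρ => fidelity (marginal i (Φ ρ)) ρ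

/-- `|Ω⟩ = (1/√d) ∑_i |ii⟩`. -/
def maxEntVec (d : ℕ) : Fin d × Fin d → ℂ :=
  fun p => if p.1 = p.2 then (((Real.sqrt d)⁻¹ : ℝ) : ℂ) else 0

/-- The maximally entangled state `ω = |Ω⟩⟨Ω|`. -/
def maxEntState (d : ℕ) : Matrix (Fin d × Fin d) (Fin d × Fin d) ℂ :=
  Matrix.vecMulVec (maxEntVec d) (star (maxEntVec d))

/-- The maximally mixed state `I / d²` of two systems. -/
def maxMixedState (d : ℕ) : Matrix (Fin d × Fin d) (Fin d × Fin d) ℂ :=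
  (((d : ℂ) ^ 2)⁻¹) • 1

/-- `M_{(0,i)} ⊗ I^{⊗(N-1)}`: the matrix `M` on the input and the `i`-th copy, the identity on
the other copies. -/
def onPair {n d : ℕ} (M : Matrix (Fin d × Fin d) (Fin d × Fin d) ℂ) (i : Fin (n + 1)) :
    TensorMat (n + 2) d :=
  Matrix.of fun x y => M (x 0, x i.succ) (y 0, y i.succ) *
    if ∀ j : Fin n, x (i.succAbove j).succ = y (i.succAbove j).succ then 1 else 0

/-- `φ_{(0,i)} ⊗ v`: the vector `φ` on the input and the `i`-th copy, and `v` on the other copies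
in increasing order. -/
def pairTensor {n d : ℕ} (φ : Fin d × Fin d → ℂ) (i : Fin (n + 1))
    (v : (Fin n → Fin d) → ℂ) : (Fin (n + 2) → Fin d) → ℂ :=
  fun x => φ (x 0, x i.succ) * v fun j => x (i.succAbove j).succ

/-- `R_a = ∑ a_i (d² I_{(0,i)} + d ω_{(0,i)}) ⊗ I^{⊗(N-1)}`. -/
def matR {n : ℕ} (d : ℕ) (a : Fin (n + 1) → ℝ) : TensorMat (n + 2) d :=
  ∑ i, (a i : ℂ) • onPair (((d : ℂ) ^ 2) • maxMixedState d + (d : ℂ) • maxEntState d) i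

/-- `S_a = ∑ a_i (d ω_{(0,i)}) ⊗ I^{⊗(N-1)}`. -/
def matS {n : ℕ} (d : ℕ) (a : Fin (n + 1) → ℝ) : TensorMat (n + 2) d :=
  ∑ i, (a i : ℂ) • onPair ((d : ℂ) • maxEntState d) i

/-- The largest (real) eigenvalue of a matrix; used for Hermitian matrices of positive size, for
which the set below is finite and non-empty. -/
def maxEigenvalue {m : Type} [Fintype m] [DecidableEq m] (A : Matrix m m ℂ) : ℝ :=
  sSup {μ : ℝ | Module.End.HasEigenvalue (Matrix.toLin' A) (μ : ℂ)}

/-- The vector `χ = ∑ b_i (√d |Ω⟩_{(0,i)}) ⊗ |v⟩`. -/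
def chiVec {n d : ℕ} (b : Fin (n + 1) → ℝ) (v : (Fin n → Fin d) → ℂ) :
    (Fin (n + 2) → Fin d) → ℂ :=
  ∑ i, (b i : ℂ) • pairTensor (((Real.sqrt d : ℝ) : ℂ) • maxEntVec d) i v

/-- `χ = ∑ b_i (√d |Ω⟩_{(0,i)}) ⊗ |v⟩`, with `v` a unit vector of the symmetric subspace, is a
normalized eigenvector of `S_a` for its largest eigenvalue. -/
structure IsTopEigenvector {n d : ℕ} (a b : Fin (n + 1) → ℝ) (v : (Fin n → Fin d) → ℂ) :
    Prop where
  symmetric : v ∈ symmetricSubspace n d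
  unit : star v ⬝ᵥ v = 1
  normalized : star (chiVec b v) ⬝ᵥ chiVec b v = 1
  eigenvector : (matS d a).mulVec (chiVec b v) = (maxEigenvalue (matS d a) : ℂ) • chiVec b v

end

end Cloning

/-! The fidelity with a pure state |u⟩⟨u| is ⟨u, ρ u⟩, so averaging it for a marginal of a linear
map only involves the fourth moments of the unit sphere (`moment4_eq`). For a channel the figure of
merit becomes (d + ∑ a_i o_i) / (d (d + 1)), where o_i is the overlap of the i-th marginal with the
identity (`performance_eq`). If the Choi matrix is ∑ |f_k⟩⟨f_k|, then ∑ a_i o_i = ∑ ⟨f_k, S_a f_k⟩,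
while trace preservation gives ∑ ‖f_k‖² = d. Hence the performance is at most (1 + λ_max(S_a)) / (d
+ 1), and 1 + S_a = R_a.

To find λ_max(S_a), write V_i for `insertPair i`, so that S_a = ∑ a_i V_i V_i^*. Here V_i^* V_i = d,
and for i ≠ j the operator V_i^* V_j merely permutes tensor factors. So |⟨V_i g, V_j h⟩| ≤ G_ij ‖g‖
‖h‖ with G = `gram`, and ⟨V_i v, V_j v⟩ = G_ij ‖v‖² when v is permutation invariant. The problem
thus reduces to the N × N matrix K_ij = √a_i √a_j G_ij (`formS_le`). Its entries are nonnegative, so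
its top eigenvector can be taken nonnegative; it yields the weights b (`exists_top_weights`).

For attainment, the columns of P^a, with the first column index read as system 0, are multiples of
vectors χ in which v is a column of the smaller symmetric projector (`weightedProjector_cons`). The
ratio of the S_a-form of χ to ‖χ‖² depends on b alone, so every Choi vector of the cloner is
optimal. Trace preservation follows from the symmetries of P^a and from the total norm d of these
vectors. -/

namespace Cloning

open MeasureTheory Metric
open scoped Pointwise

/-! ### Invariance of the surface measure under linear isometries -/

section SphereInvariance

variable {E : Type*} [NormedAddCommGroup E] [InnerProductSpace ℝ E]

/-- The action of a linear isometry on the unit sphere. -/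
def sphereMap (L : E ≃ₗᵢ[ℝ] E) (u : sphere (0 : E) 1) : sphere (0 : E) 1 :=
  ⟨L u, by simp⟩

theorem continuous_sphereMap (L : E ≃ₗᵢ[ℝ] E) : Continuous (sphereMap L) := by
  unfold sphereMap
  fun_prop

variable [FiniteDimensional ℝ E] [MeasurableSpace E] [BorelSpace E]

/-- The surface measure of s is a constant times the volume of the cone (0,1) • s. A linear isometry
maps cones to cones and preserves volume. -/
theorem measurePreserving_sphereMap (L : E ≃ₗᵢ[ℝ] E) :
    MeasurePreserving (sphereMap L) (volume : Measure E).toSphere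
      (volume : Measure E).toSphere := by
  have hm : Measurable (sphereMap L) := (continuous_sphereMap L).measurable
  refine ⟨hm, Measure.ext fun s hs => ?_⟩
  rw [Measure.map_apply hm hs, Measure.toSphere_apply' _ (hm hs), Measure.toSphere_apply' _ hs]
  have h := L.symm.measurePreserving.measure_preimage_equiv (f := L.symm.toMeasurableEquiv)
    (Set.Ioo (0 : ℝ) 1 • (Subtype.val '' (sphereMap L ⁻¹' s)))
  rw [← h]
  congr 2
  ext x
  simp only [Set.mem_smul, Set.mem_image, Set.mem_preimage,
    LinearIsometryEquiv.coe_toMeasurableEquiv]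
  constructor
  · rintro ⟨r, hr, _, ⟨u, hu, rfl⟩, h⟩
    refine ⟨r, hr, _, ⟨_, hu, rfl⟩, ?_⟩
    apply L.symm.injective
    simpa [sphereMap] using h
  · rintro ⟨r, hr, _, ⟨u, hu, rfl⟩, rfl⟩
    exact ⟨r, hr, _, ⟨sphereMap L.symm u, by simpa [sphereMap] using hu, rfl⟩, by simp [sphereMap]⟩

theorem integral_comp_sphereMap (L : E ≃ₗᵢ[ℝ] E) {f : sphere (0 : E) 1 → ℂ} (hf : Continuous f) :
    ∫ u, f (sphereMap L u) ∂(volume : Measure E).toSphere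
      = ∫ u, f u ∂(volume : Measure E).toSphere := by
  have h := measurePreserving_sphereMap L
  conv_rhs => rw [← h.map_eq]
  rw [integral_map h.measurable.aemeasurable]
  rw [h.map_eq]
  exact hf.aestronglyMeasurable

end SphereInvariance

/-! ### Fourth moments of the unit sphere of ℂ^d -/

section Moments

variable {d : ℕ}

/-- The phase rotation multiplying the `k`-th coordinate by `i`. -/
noncomputable def phaseIsometry (k : Fin d) :
    EuclideanSpace ℂ (Fin d) ≃ₗᵢ[ℝ] EuclideanSpace ℂ (Fin d) :=
  LinearIsometryEquiv.piLpCongrRight 2 fun i =>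
    if i = k then rotation (⟨Complex.I, by simp [Submonoid.unitSphere]⟩ : Circle)
    else LinearIsometryEquiv.refl ℝ ℂ

theorem phaseIsometry_apply (k i : Fin d) (u : EuclideanSpace ℂ (Fin d)) :
    phaseIsometry k u i = (if i = k then Complex.I else 1) * u i := by
  by_cases h : i = k
  · subst h
    simp only [phaseIsometry, LinearIsometryEquiv.piLpCongrRight_apply, if_true]
    exact rotation_apply _ _
  · simp [phaseIsometry, h]

/-- The rotation by `45` degrees in the plane of the coordinates `p`, `q`, composed with a
reflection. -/
noncomputable def hadamardFun (p q : Fin d) (u : EuclideanSpace ℂ (Fin d)) :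
    EuclideanSpace ℂ (Fin d) :=
  WithLp.toLp 2 fun i =>
    if i = p then ((√2 : ℝ) : ℂ)⁻¹ * (u p + u q)
    else if i = q then ((√2 : ℝ) : ℂ)⁻¹ * (u p - u q) else u i

theorem inv_sqrt_two_sq : (((√2 : ℝ) : ℂ)⁻¹) ^ 2 = 1 / 2 := by
  rw [inv_pow, ← Complex.ofReal_pow, Real.sq_sqrt (by norm_num)]
  norm_num

theorem hadamardFun_involutive {p q : Fin d} (hpq : p ≠ q) :
    Function.Involutive (hadamardFun (d := d) p q) := by
  intro u
  ext i
  have h := inv_sqrt_two_sq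
  simp only [hadamardFun, if_true, hpq.symm, if_false]
  split_ifs with h1 h2
  · subst h1; linear_combination (2 * u i) * h
  · subst h2; linear_combination (2 * u i) * h
  · rfl

theorem normSq_add_sub (a b : ℂ) :
    ‖((√2 : ℝ) : ℂ)⁻¹ * (a + b)‖ ^ 2 + ‖((√2 : ℝ) : ℂ)⁻¹ * (a - b)‖ ^ 2 = ‖a‖ ^ 2 + ‖b‖ ^ 2 := by
  have h : ‖((√2 : ℝ) : ℂ)⁻¹‖ ^ 2 = 1 / 2 := by
    rw [← norm_pow, inv_sqrt_two_sq]; norm_num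
  have h2 := parallelogram_law_with_norm ℝ a b
  rw [norm_mul, norm_mul, mul_pow, mul_pow, h]
  linarith

theorem norm_hadamardFun {p q : Fin d} (hpq : p ≠ q) (u : EuclideanSpace ℂ (Fin d)) :
    ‖hadamardFun p q u‖ = ‖u‖ := by
  rw [EuclideanSpace.norm_eq, EuclideanSpace.norm_eq]
  congr 1
  rw [← sub_eq_zero, ← Finset.sum_sub_distrib,
    Fintype.sum_eq_add p q hpq]
  · have := normSq_add_sub (u p) (u q)
    simp only [hadamardFun, if_true, hpq.symm, if_false]
    linarith
  · rintro x ⟨h1, h2⟩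
    simp [hadamardFun, h1, h2]

/-- The isometry with underlying map `hadamardFun`. -/
noncomputable def hadamardIsometry {p q : Fin d} (hpq : p ≠ q) :
    EuclideanSpace ℂ (Fin d) ≃ₗᵢ[ℝ] EuclideanSpace ℂ (Fin d) where
  toFun := hadamardFun p q
  invFun := hadamardFun p q
  left_inv := hadamardFun_involutive hpq
  right_inv := hadamardFun_involutive hpq
  map_add' u v := by
    ext i
    simp only [hadamardFun, PiLp.add_apply]
    split_ifs <;> ring
  map_smul' c u := by
    ext i
    simp only [hadamardFun, PiLp.smul_apply, Complex.real_smul, RingHom.id_apply]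
    split_ifs <;> ring
  norm_map' := norm_hadamardFun hpq

/-- The surface measure of the unit sphere of `ℂ^d`. -/
noncomputable abbrev sphereMeasure (d : ℕ) :
    Measure (sphere (0 : EuclideanSpace ℂ (Fin d)) 1) :=
  (volume : Measure (EuclideanSpace ℂ (Fin d))).toSphere

/-- The monomial `ū_x u_y u_r ū_s`. -/
noncomputable def monomial4 (x y r s : Fin d) (u : EuclideanSpace ℂ (Fin d)) : ℂ :=
  star (u x) * u y * u r * star (u s)

/-- The fourth moments of the surface measure. -/
noncomputable def moment4 (x y r s : Fin d) : ℂ :=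
  ∫ u, monomial4 x y r s (u : EuclideanSpace ℂ (Fin d)) ∂sphereMeasure d

theorem continuous_monomial4 (x y r s : Fin d) :
    Continuous fun u : sphere (0 : EuclideanSpace ℂ (Fin d)) 1 =>
      monomial4 x y r s (u : EuclideanSpace ℂ (Fin d)) := by
  unfold monomial4
  fun_prop

theorem integrable_sphere {F : Type*} [NormedAddCommGroup F]
    {f : sphere (0 : EuclideanSpace ℂ (Fin d)) 1 → F} (hf : Continuous f) :
    Integrable f (sphereMeasure d) :=
  hf.integrable_of_hasCompactSupport (HasCompactSupport.of_compactSpace f)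

theorem integral_monomial4_comp (L : EuclideanSpace ℂ (Fin d) ≃ₗᵢ[ℝ] EuclideanSpace ℂ (Fin d))
    (x y r s : Fin d) :
    ∫ u, monomial4 x y r s (L (u : EuclideanSpace ℂ (Fin d))) ∂sphereMeasure d
      = moment4 x y r s :=
  integral_comp_sphereMap L (continuous_monomial4 x y r s)

theorem moment4_phase (k x y r s : Fin d) :
    moment4 x y r s = (star (if x = k then Complex.I else 1) * (if y = k then Complex.I else 1)
      * (if r = k then Complex.I else 1) * star (if s = k then Complex.I else 1))
        * moment4 x y r s := by
  conv_lhs => rw [← integral_monomial4_comp (phaseIsometry k)]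
  conv_rhs => rw [moment4]
  rw [← integral_const_mul]
  congr 1
  ext u
  simp only [monomial4, phaseIsometry_apply, star_mul']
  ring

/-- Outside the two pairings, `x` or `s` occurs unequally often among the conjugated and the
unconjugated indices. Rotating that coordinate by i multiplies the moment by -i or -1, so it
vanishes. -/
theorem moment4_eq_zero {x y r s : Fin d} (h1 : ¬(x = y ∧ r = s)) (h2 : ¬(x = r ∧ y = s)) :
    moment4 x y r s = 0 := by
  have hI : (1 : ℂ) - Complex.I ≠ 0 := fun h => by simpa using congrArg Complex.im h
  have hI' : (1 : ℂ) + Complex.I ≠ 0 := fun h => by simpa using congrArg Complex.im h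
  have key : ∀ c : ℂ, 1 - c ≠ 0 → moment4 x y r s = c * moment4 x y r s →
      moment4 x y r s = 0 := fun c hc h => by
    have : (1 - c) * moment4 x y r s = 0 := by linear_combination h
    exact (mul_eq_zero.mp this).resolve_left hc
  have hx := moment4_phase x x y r s
  have hs := moment4_phase s x y r s
  by_cases hxs : x = s
  · subst hxs
    by_cases hy : y = x
    · have hr : r ≠ x := fun h => h1 ⟨hy.symm, h⟩
      refine key _ ?_ hx
      simpa [hy, hr] using hI'
    · by_cases hr : r = x
      · refine key _ ?_ hx
        simpa [hy, hr] using hI'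
      · refine key _ ?_ hx
        norm_num [hy, hr]
  · by_cases hy : y = x
    · have hr : r ≠ s := fun h => h1 ⟨hy.symm, h⟩
      refine key _ ?_ hs
      have : y ≠ s := fun h => hxs (hy.symm.trans h)
      simpa [hxs, this, hr] using hI'
    · by_cases hr : r = x
      · have hys : y ≠ s := fun h => h2 ⟨hr.symm, h⟩
        refine key _ ?_ hs
        have : r ≠ s := fun h => hxs (hr.symm.trans h)
        simpa [hxs, this, hys] using hI'
      · refine key _ ?_ hx
        simpa [hy, hr, Ne.symm hxs] using hI'

theorem moment4_swap (p q x y r s : Fin d) :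
    moment4 (Equiv.swap p q x) (Equiv.swap p q y) (Equiv.swap p q r) (Equiv.swap p q s)
      = moment4 x y r s := by
  rw [← integral_monomial4_comp (LinearIsometryEquiv.piLpCongrLeft 2 ℝ ℂ (Equiv.swap p q)) x y r s]
  rfl

theorem moment4_diag (p q : Fin d) : moment4 p p p p = moment4 q q q q := by
  have h := moment4_swap p q q q q q
  rwa [Equiv.swap_apply_right] at h

theorem moment4_cross_left (p q : Fin d) : moment4 p q p q = moment4 p p q q := by
  unfold moment4 monomial4
  congr 1
  ext u
  ring

/-- After the 45 degree rotation, |u_p|² |u_q|² becomes |u_p² - u_q²|² / 4. The mixed terms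
integrate to zero by phase invariance, and the two pure fourth powers have equal integrals. -/
theorem moment4_cross {p q : Fin d} (hpq : p ≠ q) :
    2 * moment4 p p q q = moment4 p p p p := by
  have h := integral_monomial4_comp (hadamardIsometry hpq) p p q q
  have e : ∀ u : EuclideanSpace ℂ (Fin d), monomial4 p p q q (hadamardIsometry hpq u)
      = (1 / 4) * (monomial4 p p p p u + monomial4 q q q q u - monomial4 p q q p u
        - monomial4 q p p q u) := by
    intro u
    have hp : hadamardIsometry hpq u p = ((√2 : ℝ) : ℂ)⁻¹ * (u p + u q) := by
      change hadamardFun p q u p = _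
      simp [hadamardFun]
    have hq : hadamardIsometry hpq u q = ((√2 : ℝ) : ℂ)⁻¹ * (u p - u q) := by
      change hadamardFun p q u q = _
      simp [hadamardFun, hpq.symm]
    have h2 := inv_sqrt_two_sq
    have h3 : (starRingEnd ℂ) (((√2 : ℝ) : ℂ)⁻¹) = ((√2 : ℝ) : ℂ)⁻¹ := by
      rw [← Complex.ofReal_inv, Complex.conj_ofReal]
    simp only [monomial4, hp, hq, Complex.star_def, map_mul, map_add, map_sub, h3]
    generalize ((√2 : ℝ) : ℂ)⁻¹ = t at h2
    have h4 : t ^ 4 = 1 / 4 := by linear_combination (t ^ 2 + 1 / 2) * h2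
    linear_combination ((starRingEnd ℂ (u p) + starRingEnd ℂ (u q)) * (u p + u q) * (u p - u q)
      * (starRingEnd ℂ (u p) - starRingEnd ℂ (u q))) * h4
  simp only [e] at h
  have i := fun x y r s : Fin d => integrable_sphere (continuous_monomial4 x y r s)
  rw [integral_const_mul, integral_sub, integral_sub, integral_add (i _ _ _ _) (i _ _ _ _)] at h
  · change 1 / 4 * (moment4 p p p p + moment4 q q q q - moment4 p q q p - moment4 q p p q)
      = moment4 p p q q at h
    rw [moment4_eq_zero (x := p) (y := q) (by tauto) (by tauto),
      moment4_eq_zero (x := q) (y := p) (by tauto) (by tauto), moment4_diag q p] at h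
    linear_combination -2 * h
  · exact (i _ _ _ _).add (i _ _ _ _)
  · exact i _ _ _ _
  · exact ((i _ _ _ _).add (i _ _ _ _)).sub (i _ _ _ _)
  · exact i _ _ _ _

theorem sum_moment4 : ∑ p : Fin d, ∑ q : Fin d, moment4 p p q q
    = (((sphereMeasure d).real Set.univ : ℝ) : ℂ) := by
  have i := fun x y r s : Fin d => integrable_sphere (continuous_monomial4 x y r s)
  have e : ∀ u : sphere (0 : EuclideanSpace ℂ (Fin d)) 1,
      ∑ p : Fin d, ∑ q : Fin d, monomial4 p p q q (u : EuclideanSpace ℂ (Fin d)) = 1 := by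
    intro u
    have hu : ∑ p, star ((u : EuclideanSpace ℂ (Fin d)) p) * (u : EuclideanSpace ℂ (Fin d)) p
        = 1 := by
      have h1 : ‖(u : EuclideanSpace ℂ (Fin d))‖ ^ 2 = 1 := by simp
      rw [EuclideanSpace.norm_sq_eq] at h1
      have h2 := congrArg (fun t : ℝ => (t : ℂ)) h1
      simpa [Complex.conj_mul'] using h2
    calc _ = (∑ p, star ((u : EuclideanSpace ℂ (Fin d)) p) * (u : EuclideanSpace ℂ (Fin d)) p)
          * ∑ p, star ((u : EuclideanSpace ℂ (Fin d)) p) * (u : EuclideanSpace ℂ (Fin d)) p := by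
            rw [Finset.sum_mul_sum]
            refine Finset.sum_congr rfl fun p _ => Finset.sum_congr rfl fun q _ => ?_
            simp only [monomial4]
            ring
      _ = 1 := by rw [hu, one_mul]
  calc _ = ∫ u, ∑ p : Fin d, ∑ q : Fin d, monomial4 p p q q (u : EuclideanSpace ℂ (Fin d))
        ∂sphereMeasure d := by
        rw [integral_finsetSum _ fun p _ => integrable_finsetSum _ fun q _ => i p p q q]
        refine Finset.sum_congr rfl fun p _ => ?_
        rw [integral_finsetSum _ fun q _ => i p p q q]
        rfl
    _ = _ := by simp [e]

/-- Integrating (∑ |u_p|²)² = 1 and using that the cross moments are half the diagonal ones leaves d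
(d + 1) / 2 times the diagonal moment equal to the total mass. -/
theorem moment4_diag_eq (p : Fin d) : moment4 p p p p
    = 2 / ((d : ℂ) * (d + 1)) * (((sphereMeasure d).real Set.univ : ℝ) : ℂ) := by
  have h : ∀ x y : Fin d, 2 * moment4 x x y y
      = moment4 p p p p + (if x = y then moment4 p p p p else 0) := by
    intro x y
    by_cases hxy : x = y
    · subst hxy
      rw [if_pos rfl, moment4_diag x p]
      ring
    · rw [if_neg hxy, moment4_cross hxy, moment4_diag x p, add_zero]
  have hs := sum_moment4 (d := d)
  have hs2 : ∑ x : Fin d, ∑ y : Fin d, 2 * moment4 x x y y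
      = 2 * (((sphereMeasure d).real Set.univ : ℝ) : ℂ) := by
    rw [← hs]
    simp only [Finset.mul_sum]
  simp only [h, Finset.sum_add_distrib, Finset.sum_ite_eq, Finset.mem_univ, if_true,
    Finset.sum_const, Finset.card_univ, Fintype.card_fin, nsmul_eq_mul] at hs2
  have hd : (d : ℂ) ≠ 0 := by
    have := p.pos
    exact_mod_cast this.ne'
  have hd1 : (d : ℂ) + 1 ≠ 0 := by exact_mod_cast Nat.succ_ne_zero d
  field_simp
  linear_combination hs2

/-- The fourth moments of the uniform measure on the sphere of `ℂ^d`. -/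
theorem moment4_eq (x y r s : Fin d) : moment4 x y r s
    = ((if x = y ∧ r = s then 1 else 0) + (if x = r ∧ y = s then 1 else 0)) / ((d : ℂ) * (d + 1))
      * (((sphereMeasure d).real Set.univ : ℝ) : ℂ) := by
  by_cases h1 : x = y ∧ r = s
  · obtain ⟨rfl, rfl⟩ := h1
    by_cases hxr : x = r
    · subst hxr
      rw [moment4_diag_eq]
      norm_num
    · have := moment4_cross hxr
      rw [moment4_diag_eq] at this
      simp only [hxr, and_self, if_true, if_false]
      linear_combination this / 2
  · by_cases h2 : x = r ∧ y = s
    · obtain ⟨rfl, rfl⟩ := h2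
      have hxy : x ≠ y := fun h => h1 ⟨h, h⟩
      have := moment4_cross hxy
      rw [moment4_diag_eq] at this
      rw [moment4_cross_left]
      simp only [hxy, and_self, if_true, if_false]
      linear_combination this / 2
    · rw [moment4_eq_zero h1 h2, if_neg h1, if_neg h2]
      simp

end Moments

theorem average_sum_monomial4 {d : ℕ} (hd : 1 ≤ d) (T : Fin d → Fin d → Fin d → Fin d → ℂ) :
    average (sphereMeasure d) (fun u => (∑ x, ∑ y, ∑ r, ∑ s, T x y r s *
        monomial4 x y r s (u : EuclideanSpace ℂ (Fin d))).re)
      = ((∑ x, ∑ r, T x x r r) + ∑ x, ∑ y, T x y x y).re / (d * (d + 1)) := by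
  have : Nonempty (Fin d) := ⟨⟨0, hd⟩⟩
  have hμ : (sphereMeasure d).real Set.univ ≠ 0 := by
    rw [Ne, measureReal_eq_zero_iff, Measure.measure_univ_eq_zero]
    exact Measure.toSphere_ne_zero _
  have i := fun x y r s : Fin d => (integrable_sphere (continuous_monomial4 x y r s)).const_mul
    (T x y r s)
  have i4 : Integrable (fun u : sphere (0 : EuclideanSpace ℂ (Fin d)) 1 =>
      ∑ x, ∑ y, ∑ r, ∑ s, T x y r s * monomial4 x y r s (u : EuclideanSpace ℂ (Fin d)))
      (sphereMeasure d) :=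
    integrable_finsetSum _ fun x _ => integrable_finsetSum _ fun y _ =>
      integrable_finsetSum _ fun r _ => integrable_finsetSum _ fun s _ => i x y r s
  have hint : ∫ u, ∑ x, ∑ y, ∑ r, ∑ s, T x y r s *
      monomial4 x y r s (u : EuclideanSpace ℂ (Fin d)) ∂sphereMeasure d
      = ∑ x, ∑ y, ∑ r, ∑ s, T x y r s * moment4 x y r s := by
    rw [integral_finsetSum _ fun x _ => integrable_finsetSum _ fun y _ =>
      integrable_finsetSum _ fun r _ => integrable_finsetSum _ fun s _ => i x y r s]
    refine Finset.sum_congr rfl fun x _ => ?_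
    rw [integral_finsetSum _ fun y _ =>
      integrable_finsetSum _ fun r _ => integrable_finsetSum _ fun s _ => i x y r s]
    refine Finset.sum_congr rfl fun y _ => ?_
    rw [integral_finsetSum _ fun r _ => integrable_finsetSum _ fun s _ => i x y r s]
    refine Finset.sum_congr rfl fun r _ => ?_
    rw [integral_finsetSum _ fun s _ => i x y r s]
    refine Finset.sum_congr rfl fun s _ => ?_
    rw [integral_const_mul]
    rfl
  have hsum : ∑ x, ∑ y, ∑ r, ∑ s, T x y r s * moment4 x y r s
      = ((∑ x, ∑ r, T x x r r) + ∑ x, ∑ y, T x y x y) / ((d : ℂ) * (d + 1))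
        * (((sphereMeasure d).real Set.univ : ℝ) : ℂ) := by
    have e : ∀ x y r s : Fin d, T x y r s * moment4 x y r s
        = ((if x = y then (if r = s then T x y r s else 0) else 0)
          + (if x = r then (if y = s then T x y r s else 0) else 0)) *
          (((d : ℂ) * (d + 1))⁻¹ * (((sphereMeasure d).real Set.univ : ℝ) : ℂ)) := by
      intro x y r s
      rw [moment4_eq, ite_and, ite_and]
      split_ifs <;> ring
    simp only [e, ← Finset.sum_mul, Finset.sum_add_distrib, Finset.sum_ite_eq, Finset.mem_univ,
      if_true, Finset.sum_const_zero, Finset.sum_ite_irrel]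
    ring
  rw [average_eq]
  have hre := integral_re i4
  simp only [RCLike.re_eq_complex_re] at hre
  rw [hre, hint, hsum, Complex.re_mul_ofReal, smul_eq_mul]
  have : (d : ℂ) * (d + 1) = ((d * (d + 1) : ℝ) : ℂ) := by push_cast; ring
  rw [this, Complex.div_ofReal_re]
  field_simp

/-! ### Fidelity with a pure state -/

section Fidelity

open scoped ComplexOrder MatrixOrder

theorem posSemidef_pureState {d : ℕ} (u : sphere (0 : EuclideanSpace ℂ (Fin d)) 1) :
    (pureState u).PosSemidef :=
  Matrix.posSemidef_vecMulVec_self_star _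

theorem fidelity_pureState {d : ℕ} {ρ : Matrix (Fin d) (Fin d) ℂ} (hρ : ρ.PosSemidef)
    (u : sphere (0 : EuclideanSpace ℂ (Fin d)) 1) :
    fidelity ρ (pureState u) = (star (u : EuclideanSpace ℂ (Fin d)).ofLp ⬝ᵥ
      ρ.mulVec (u : EuclideanSpace ℂ (Fin d)).ofLp).re := by
  set w := (u : EuclideanSpace ℂ (Fin d)).ofLp with hw
  have hunit : star w ⬝ᵥ w = 1 := by
    have h1 : ‖(u : EuclideanSpace ℂ (Fin d))‖ ^ 2 = 1 := by simp
    rw [EuclideanSpace.norm_sq_eq] at h1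
    have h2 := congrArg (fun t : ℝ => (t : ℂ)) h1
    simpa [Complex.conj_mul', dotProduct] using h2
  have hpsd := posSemidef_pureState u
  have hidem : pureState u * pureState u = pureState u := by
    rw [pureState, Matrix.vecMulVec_mul_vecMulVec, hunit, one_smul]
  have hsq : CFC.sqrt (pureState u) = pureState u :=
    CFC.sqrt_unique hidem hpsd.nonneg
  set c := (star w ⬝ᵥ ρ.mulVec w).re with hc
  have hc0 : 0 ≤ star w ⬝ᵥ ρ.mulVec w := hρ.dotProduct_mulVec_nonneg w
  have hcc : star w ⬝ᵥ ρ.mulVec w = (c : ℂ) := (Complex.eq_re_of_ofReal_le hc0)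
  have hcnn : 0 ≤ c := (Complex.nonneg_iff.mp hc0).1
  -- A pure state is its own square root, and compressing by it leaves the scalar c = ⟨u, ρ u⟩; the
  -- root of the compression then has trace √c.
  have hmid : pureState u * ρ * pureState u = (c : ℂ) • pureState u := by
    rw [pureState, ← hw, Matrix.mul_vecMulVec, ← Matrix.mulVec_mulVec, Matrix.vecMulVec_mulVec, hcc,
      op_smul_eq_smul, Matrix.smul_vecMulVec]
  have hsqrt : CFC.sqrt ((c : ℂ) • pureState u) = ((√c : ℝ) : ℂ) • pureState u := by
    refine CFC.sqrt_unique ?_ ?_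
    · rw [smul_mul_smul_comm, hidem, ← Complex.ofReal_mul, Real.mul_self_sqrt hcnn]
    · exact (hpsd.smul (Complex.zero_le_real.mpr (Real.sqrt_nonneg c))).nonneg
  have htr : (pureState u).trace = 1 := by
    rw [pureState, Matrix.trace_vecMulVec, dotProduct_comm, hunit]
  rw [fidelity, hsq, hmid, hsqrt, Matrix.trace_smul, htr, smul_eq_mul, mul_one, Complex.ofReal_re,
    Real.sq_sqrt hcnn]

end Fidelity

/-! ### The figure of merit as a linear functional of the channel -/

section Channel

open scoped ComplexOrder MatrixOrder

theorem IsQuantumChannel.posSemidef_map {m m' : Type} [Fintype m] [Fintype m']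
    {Φ : Matrix m m ℂ →ₗ[ℂ] Matrix m' m' ℂ} (hΦ : IsQuantumChannel Φ) {ρ : Matrix m m ℂ}
    (hρ : ρ.PosSemidef) : (Φ ρ).PosSemidef :=
  (hΦ.completelyPositive 1 (ρ.submatrix Prod.fst Prod.fst) (hρ.submatrix _)).submatrix
    fun i => (i, 0)

theorem posSemidef_marginal {n d : ℕ} (i : Fin (n + 1)) {M : TensorMat (n + 1) d}
    (hM : M.PosSemidef) : (marginal i M).PosSemidef := by
  have : marginal i M = ∑ z : Fin n → Fin d,
      M.submatrix (fun r => Fin.insertNth (α := fun _ => Fin d) i r z)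
        (fun r => Fin.insertNth (α := fun _ => Fin d) i r z) := by
    ext r s
    simp [marginal, Matrix.sum_apply]
  rw [this]
  exact Matrix.posSemidef_sum _ fun z _ => hM.submatrix _

/-- The overlap `∑ ⟨x| Φ_i(|x⟩⟨y|) |y⟩` of the `i`-th marginal channel with the identity. -/
noncomputable def entanglementOverlap {n d : ℕ}
    (Φ : Matrix (Fin d) (Fin d) ℂ →ₗ[ℂ] TensorMat (n + 1) d) (i : Fin (n + 1)) : ℂ :=
  ∑ x, ∑ y, marginal i (Φ (Matrix.single x y 1)) x y

theorem trace_marginal {n d : ℕ} (i : Fin (n + 1)) (M : TensorMat (n + 1) d) :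
    (marginal i M).trace = M.trace := by
  simp only [Matrix.trace, Matrix.diag_apply, marginal, Matrix.of_apply]
  rw [← Fintype.sum_prod_type']
  exact (Fin.insertNthEquiv (fun _ => Fin d) i).sum_comp fun x => M x x

theorem map_apply_eq_sum {n d : ℕ} (Φ : Matrix (Fin d) (Fin d) ℂ →ₗ[ℂ] TensorMat (n + 1) d)
    (X : Matrix (Fin d) (Fin d) ℂ) (x y : Fin (n + 1) → Fin d) :
    Φ X x y = ∑ r, ∑ s, X r s * Φ (Matrix.single r s 1) x y := by
  have h : X = ∑ r, ∑ s, X r s • Matrix.single r s (1 : ℂ) := by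
    conv_lhs => rw [Matrix.matrix_eq_sum_single X]
    simp [Matrix.smul_single]
  conv_lhs => rw [h]
  simp only [map_sum, map_smul, Matrix.sum_apply, Matrix.smul_apply, smul_eq_mul]

theorem marginal_map_eq_sum {n d : ℕ} (i : Fin (n + 1))
    (Φ : Matrix (Fin d) (Fin d) ℂ →ₗ[ℂ] TensorMat (n + 1) d) (ρ : Matrix (Fin d) (Fin d) ℂ)
    (x y : Fin d) : marginal i (Φ ρ) x y
      = ∑ r, ∑ s, ρ r s * marginal i (Φ (Matrix.single r s 1)) x y := by
  simp only [marginal, Matrix.of_apply, map_apply_eq_sum Φ ρ, Finset.mul_sum]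
  rw [Finset.sum_comm]
  exact Finset.sum_congr rfl fun r _ => Finset.sum_comm

/-- Of the two index pairings in the fourth moment, one gives the traces of the images of the
diagonal matrix units, d in total, and the other gives the overlap. -/
theorem pureAverage_fidelity_marginal {n d : ℕ} (hd : 1 ≤ d)
    {Φ : Matrix (Fin d) (Fin d) ℂ →ₗ[ℂ] TensorMat (n + 1) d} (hΦ : IsQuantumChannel Φ)
    (i : Fin (n + 1)) : pureAverage (fun ρ => fidelity (marginal i (Φ ρ)) ρ)
      = (d + (entanglementOverlap Φ i).re) / (d * (d + 1)) := by
  have key : ∀ u : sphere (0 : EuclideanSpace ℂ (Fin d)) 1,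
      fidelity (marginal i (Φ (pureState u))) (pureState u)
        = (∑ x, ∑ y, ∑ r, ∑ s, marginal i (Φ (Matrix.single r s 1)) x y *
          monomial4 x y r s (u : EuclideanSpace ℂ (Fin d))).re := by
    intro u
    rw [fidelity_pureState (posSemidef_marginal i
      (hΦ.posSemidef_map (posSemidef_pureState u)))]
    congr 1
    simp only [dotProduct, Matrix.mulVec, Finset.mul_sum, marginal_map_eq_sum i Φ (pureState u),
      Finset.sum_mul]
    refine Finset.sum_congr rfl fun x _ => Finset.sum_congr rfl fun y _ =>
      Finset.sum_congr rfl fun r _ => Finset.sum_congr rfl fun s _ => ?_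
    simp only [monomial4, pureState, Matrix.vecMulVec_apply, Pi.star_apply]
    ring
  rw [pureAverage]
  simp only [key]
  rw [average_sum_monomial4 hd (fun x y r s => marginal i (Φ (Matrix.single r s 1)) x y)]
  have htr : ∑ x, ∑ r, marginal i (Φ (Matrix.single r r 1)) x x = (d : ℂ) := by
    rw [Finset.sum_comm]
    have : ∀ r : Fin d, ∑ x, marginal i (Φ (Matrix.single r r 1)) x x = 1 := by
      intro r
      have h := trace_marginal i (Φ (Matrix.single r r 1))
      rw [hΦ.tracePreserving, Matrix.trace_single_eq_same] at h
      exact h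
    simp [this]
  rw [htr, Complex.add_re, Complex.natCast_re]
  rfl

theorem performance_eq {n d : ℕ} (hd : 1 ≤ d) {a : Fin (n + 1) → ℝ} (ha : ∑ i, a i = 1)
    {Φ : Matrix (Fin d) (Fin d) ℂ →ₗ[ℂ] TensorMat (n + 1) d} (hΦ : IsQuantumChannel Φ) :
    performance a Φ
      = (d + ∑ i, a i * (entanglementOverlap Φ i).re) / (d * (d + 1)) := by
  simp only [performance, pureAverage_fidelity_marginal hd hΦ]
  simp only [mul_div_assoc', ← Finset.sum_div, mul_add, Finset.sum_add_distrib, ← Finset.sum_mul, ha,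
    one_mul]

end Channel

/-! ### Maximally entangled pairs, their Gram matrix and the form of S_a -/

section Pairs

variable {n d : ℕ}

/-- The map `g ↦ (√d Ω)_{(0,i)} ⊗ g`. -/
noncomputable def insertPair (i : Fin (n + 1)) (g : (Fin n → Fin d) → ℂ) :
    (Fin (n + 2) → Fin d) → ℂ :=
  pairTensor (((Real.sqrt d : ℝ) : ℂ) • maxEntVec d) i g

theorem insertPair_apply (i : Fin (n + 1)) (g : (Fin n → Fin d) → ℂ) (x : Fin (n + 2) → Fin d) :
    insertPair i g x
      = if x 0 = x i.succ then g (fun j => x (i.succAbove j).succ) else 0 := by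
  have hd : (√(d : ℝ)) ≠ 0 := by
    have := (x 0).pos
    positivity
  simp only [insertPair, pairTensor, maxEntVec, Pi.smul_apply, smul_eq_mul]
  split_ifs
  · rw [← Complex.ofReal_mul, mul_inv_cancel₀ hd, Complex.ofReal_one, one_mul]
  · simp

/-- The adjoint of `insertPair i`. -/
noncomputable def contractPair (i : Fin (n + 1)) (f : (Fin (n + 2) → Fin d) → ℂ) :
    (Fin n → Fin d) → ℂ :=
  fun z => ∑ t, f (Fin.cons t (Fin.insertNth i t z))

theorem sum_cons_insertNth {M : Type*} [AddCommMonoid M] (i : Fin (n + 1))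
    (F : (Fin (n + 2) → Fin d) → M) :
    ∑ x, F x = ∑ s : Fin d, ∑ t : Fin d, ∑ z : Fin n → Fin d,
      F (Fin.cons s (Fin.insertNth i t z)) := by
  rw [← (Fin.consEquiv fun _ : Fin (n + 2) => Fin d).sum_comp, Fintype.sum_prod_type]
  refine Finset.sum_congr rfl fun s _ => ?_
  rw [← (Fin.insertNthEquiv (fun _ : Fin (n + 1) => Fin d) i).sum_comp, Fintype.sum_prod_type]
  rfl

theorem insertPair_cons (i : Fin (n + 1)) (g : (Fin n → Fin d) → ℂ) (s t : Fin d)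
    (z : Fin n → Fin d) :
    insertPair i g (Fin.cons s (Fin.insertNth i t z)) = if s = t then g z else 0 := by
  rw [insertPair_apply]
  simp

theorem star_dotProduct_insertPair (i : Fin (n + 1)) (f : (Fin (n + 2) → Fin d) → ℂ)
    (g : (Fin n → Fin d) → ℂ) :
    star f ⬝ᵥ insertPair i g = star (contractPair i f) ⬝ᵥ g := by
  simp only [dotProduct, sum_cons_insertNth i, insertPair_cons, Pi.star_apply, contractPair,
    star_sum, Finset.sum_mul, mul_ite, mul_zero]
  rw [Finset.sum_comm (s := (Finset.univ : Finset (Fin n → Fin d)))]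
  refine Finset.sum_congr rfl fun s _ => ?_
  rw [Finset.sum_comm]
  simp

theorem onPair_apply (i : Fin (n + 1)) (x y : Fin (n + 2) → Fin d) :
    onPair (n := n) ((d : ℂ) • maxEntState d) i x y
      = if x 0 = x i.succ then (if y 0 = y i.succ then
          (if (∀ j, x (i.succAbove j).succ = y (i.succAbove j).succ) then 1 else 0) else 0)
        else 0 := by
  have hd : (0 : ℝ) < d := by
    have := (x 0).pos
    positivity
  have h : ((√(d : ℝ))⁻¹ : ℝ) * ((√(d : ℝ))⁻¹ : ℝ) = (d : ℝ)⁻¹ := by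
    rw [← mul_inv, Real.mul_self_sqrt hd.le]
  have h' : (d : ℂ) * ((((√(d : ℝ))⁻¹ : ℝ) : ℂ) * (((√(d : ℝ))⁻¹ : ℝ) : ℂ)) = 1 := by
    rw [← Complex.ofReal_mul, h, Complex.ofReal_inv, Complex.ofReal_natCast, mul_inv_cancel₀]
    exact_mod_cast hd.ne'
  simp only [onPair, Matrix.of_apply, Matrix.smul_apply, maxEntState, Matrix.vecMulVec_apply,
    maxEntVec, Pi.star_apply, smul_eq_mul]
  by_cases h1 : x 0 = x i.succ
  · by_cases h2 : y 0 = y i.succ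
    · simp only [h1, h2, if_true, Complex.star_def, Complex.conj_ofReal, h', one_mul]
    · simp [h2]
  · simp [h1]

theorem onPair_mulVec (i : Fin (n + 1)) (f : (Fin (n + 2) → Fin d) → ℂ) :
    (onPair ((d : ℂ) • maxEntState d) i).mulVec f = insertPair i (contractPair i f) := by
  ext x
  rw [insertPair_apply]
  simp only [Matrix.mulVec, dotProduct, onPair_apply]
  split_ifs with h
  · rw [sum_cons_insertNth i, contractPair]
    refine Finset.sum_congr rfl fun s _ => ?_
    simp only [Fin.cons_zero, Fin.cons_succ, Fin.insertNth_apply_same,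
      Fin.insertNth_apply_succAbove, ← funext_iff]
    rw [Finset.sum_comm]
    simp [Finset.sum_ite_eq]
  · simp

theorem matS_mulVec (a : Fin (n + 1) → ℝ) (f : (Fin (n + 2) → Fin d) → ℂ) :
    (matS d a).mulVec f = ∑ i, (a i : ℂ) • insertPair i (contractPair i f) := by
  simp only [matS, Matrix.sum_mulVec, Matrix.smul_mulVec, onPair_mulVec]

theorem exists_perm_swap_succAbove (i j : Fin (n + 1)) :
    ∃ π : Equiv.Perm (Fin n), ∀ l, Equiv.swap i j (j.succAbove l) = i.succAbove (π l) := by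
  have h : ∀ l, ∃ m, i.succAbove m = Equiv.swap i j (j.succAbove l) := fun l =>
    Fin.exists_succAbove_eq fun h => Fin.succAbove_ne j l <| by
      rw [← (Equiv.swap i j).apply_eq_iff_eq, h, Equiv.swap_apply_right]
  choose π hπ using h
  have hinj : Function.Injective π := fun l m hlm => by
    have := hπ l
    rw [hlm, hπ m] at this
    exact (Fin.succAbove_right_injective ((Equiv.swap i j).injective this)).symm
  exact ⟨Equiv.ofBijective π (Finite.injective_iff_bijective.mp hinj), fun l => (hπ l).symm⟩

theorem contractPair_insertPair_self (i : Fin (n + 1)) (g : (Fin n → Fin d) → ℂ) :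
    contractPair i (insertPair i g) = (d : ℂ) • g := by
  ext z
  simp [contractPair, insertPair_cons]

/-- System 0 is paired with copy j and then contracted with copy i. For i ≠ j no closed loop forms:
the state on copy i is carried over to copy j, which only reorders the factors. -/
theorem exists_perm_contractPair_insertPair {i j : Fin (n + 1)} (hij : i ≠ j) :
    ∃ π : Equiv.Perm (Fin n), ∀ (g : (Fin n → Fin d) → ℂ),
      contractPair i (insertPair j g) = fun z => g (z ∘ π) := by
  obtain ⟨π, hπ⟩ := exists_perm_swap_succAbove i j
  -- Copy j is the m-th of the copies other than i, so the inserted pair forces the contracted index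
  -- t to equal z m.
  obtain ⟨m, hm⟩ := Fin.exists_succAbove_eq hij.symm
  refine ⟨π, fun g => ?_⟩
  ext z
  have hz : ∀ t : Fin d, t = z m →
      (fun l => (Fin.insertNth (α := fun _ => Fin d) i t z : Fin (n + 1) → Fin d)
        (j.succAbove l)) = z ∘ π := by
    rintro t rfl
    ext l
    have := hπ l
    by_cases hl : j.succAbove l = i
    · rw [hl, Equiv.swap_apply_left, ← hm] at this
      rw [hl, Fin.insertNth_apply_same, Function.comp_apply, Fin.succAbove_right_injective this]
    · rw [Equiv.swap_apply_of_ne_of_ne hl (Fin.succAbove_ne j l)] at this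
      rw [this, Fin.insertNth_apply_succAbove, Function.comp_apply]
  simp only [contractPair, insertPair_apply, Fin.cons_zero, Fin.cons_succ]
  rw [Finset.sum_eq_single (z m)]
  · conv_lhs => rw [← hm]
    rw [Fin.insertNth_apply_succAbove, if_pos rfl]
    rw [hm, hz _ rfl]
  · intro t _ ht
    conv_lhs => rw [← hm]
    rw [Fin.insertNth_apply_succAbove, if_neg ht]
  · simp

/-- Invariance of a tensor under all permutations of the tensor factors. -/
def IsPermInvariant (v : (Fin n → Fin d) → ℂ) : Prop :=
  ∀ (π : Equiv.Perm (Fin n)) (z : Fin n → Fin d), v (z ∘ π) = v z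

/-- Only this consequence of membership is needed. The columns of P⁺ share it
(`isPermInvariant_symColumn`), so the image of P⁺ need not be compared with the span of tensor
powers. -/
theorem isPermInvariant_of_mem {v : (Fin n → Fin d) → ℂ} (hv : v ∈ symmetricSubspace n d) :
    IsPermInvariant v := by
  intro π z
  induction hv using Submodule.span_induction with
  | mem x hx =>
    obtain ⟨w, rfl⟩ := hx
    exact Equiv.prod_comp π fun l => w (z l)
  | zero => rfl
  | add x y _ _ hx hy => simp [hx, hy]
  | smul c x _ hx => simp [hx]

/-- The Gram matrix of the vectors `(√d Ω)_{(0,i)} ⊗ v`, for a permutation invariant unit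
vector `v`. -/
def gram (n d : ℕ) (i j : Fin (n + 1)) : ℝ := if i = j then d else 1

theorem gram_comm (i j : Fin (n + 1)) : gram n d i j = gram n d j i := by
  simp [gram, eq_comm]

theorem IsPermInvariant.contractPair_insertPair {v : (Fin n → Fin d) → ℂ}
    (hv : IsPermInvariant v) (i j : Fin (n + 1)) :
    contractPair i (insertPair j v) = (gram n d i j : ℂ) • v := by
  by_cases hij : i = j
  · subst hij
    simp [contractPair_insertPair_self, gram]
  · obtain ⟨π, hπ⟩ := exists_perm_contractPair_insertPair (d := d) hij
    rw [hπ]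
    ext z
    simp [hv π z, gram, hij]

/-- The `ℓ²` norm of a tensor. -/
noncomputable def l2norm {ι : Type*} [Fintype ι] (f : ι → ℂ) : ℝ := ‖WithLp.toLp 2 f‖

theorem star_dotProduct_self {ι : Type*} [Fintype ι] (f : ι → ℂ) :
    star f ⬝ᵥ f = ((l2norm f ^ 2 : ℝ) : ℂ) := by
  rw [l2norm, EuclideanSpace.norm_sq_eq]
  simp [dotProduct, Complex.conj_mul']

theorem norm_star_dotProduct_le {ι : Type*} [Fintype ι] (f g : ι → ℂ) :
    ‖star f ⬝ᵥ g‖ ≤ l2norm f * l2norm g := by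
  have h := norm_inner_le_norm (𝕜 := ℂ) (WithLp.toLp 2 f) (WithLp.toLp 2 g)
  rwa [EuclideanSpace.inner_eq_star_dotProduct, dotProduct_comm] at h

theorem l2norm_comp_perm (π : Equiv.Perm (Fin n)) (g : (Fin n → Fin d) → ℂ) :
    l2norm (fun z => g (z ∘ π)) = l2norm g := by
  rw [l2norm, l2norm, EuclideanSpace.norm_eq, EuclideanSpace.norm_eq]
  congr 1
  exact (Equiv.arrowCongr π.symm (Equiv.refl (Fin d))).sum_comp fun z => ‖g z‖ ^ 2

theorem norm_star_insertPair_dotProduct_le (i j : Fin (n + 1)) (g h : (Fin n → Fin d) → ℂ) :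
    ‖star (insertPair i g) ⬝ᵥ insertPair j h‖ ≤ gram n d i j * (l2norm g * l2norm h) := by
  rw [star_dotProduct_insertPair]
  by_cases hij : j = i
  · subst hij
    rw [contractPair_insertPair_self, star_smul, smul_dotProduct, norm_smul]
    simpa [gram] using mul_le_mul_of_nonneg_left (norm_star_dotProduct_le g h) (Nat.cast_nonneg d)
  · obtain ⟨π, hπ⟩ := exists_perm_contractPair_insertPair (d := d) hij
    rw [hπ, gram, if_neg (Ne.symm hij), one_mul]
    refine (norm_star_dotProduct_le _ _).trans (le_of_eq ?_)
    rw [l2norm_comp_perm]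

/-- The quadratic form of `S_a`. -/
noncomputable def formS (a : Fin (n + 1) → ℝ) (f : (Fin (n + 2) → Fin d) → ℂ) : ℝ :=
  ∑ i, a i * l2norm (contractPair i f) ^ 2

theorem star_dotProduct_matS_mulVec (a : Fin (n + 1) → ℝ) (f : (Fin (n + 2) → Fin d) → ℂ) :
    star f ⬝ᵥ (matS d a).mulVec f = (formS a f : ℂ) := by
  simp only [matS_mulVec, dotProduct_sum, dotProduct_smul, star_dotProduct_insertPair,
    star_dotProduct_self, formS, Complex.ofReal_sum, Complex.ofReal_mul, smul_eq_mul]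

/-- With h = S_a f and c_i = √a_i ‖V_i^* f‖, the Gram bounds give ‖h‖² ≤ ∑ K_ij c_i c_j ≤ μ ∑ c_i² =
μ ⟨f, h⟩. Together with Cauchy–Schwarz, ⟨f, h⟩² ≤ ‖f‖² μ ⟨f, h⟩. No symmetry of f is assumed, so the
bound covers the whole space. -/
theorem formS_le {a : Fin (n + 1) → ℝ} (ha : ∀ i, 0 ≤ a i) {μ : ℝ}
    (hμ : ∀ c : Fin (n + 1) → ℝ,
      ∑ i, ∑ j, √(a i) * √(a j) * gram n d i j * (c i * c j) ≤ μ * ∑ i, c i ^ 2)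
    (f : (Fin (n + 2) → Fin d) → ℂ) : formS a f ≤ μ * l2norm f ^ 2 := by
  set g := fun i => contractPair i f with hg
  set h := (matS d a).mulVec f with hh
  have hQ0 : 0 ≤ formS a f := Finset.sum_nonneg fun i _ => mul_nonneg (ha i) (sq_nonneg _)
  have h1 : formS a f ≤ l2norm f * l2norm h := by
    have := norm_star_dotProduct_le f h
    rwa [star_dotProduct_matS_mulVec, Complex.norm_real, Real.norm_of_nonneg hQ0] at this
  have h2 : l2norm h ^ 2 ≤ μ * formS a f := by
    have e : star h ⬝ᵥ h = ∑ i, ∑ j, ((a i : ℂ) * (a j : ℂ)) *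
        (star (insertPair i (g i)) ⬝ᵥ insertPair j (g j)) := by
      rw [hh, matS_mulVec]
      simp only [star_sum, sum_dotProduct, dotProduct_sum, star_smul, smul_dotProduct,
        dotProduct_smul, smul_eq_mul, Complex.star_def, Complex.conj_ofReal, hg]
      rw [Finset.sum_comm]
      simp only [Finset.mul_sum]
      refine Finset.sum_congr rfl fun i _ => Finset.sum_congr rfl fun j _ => ?_
      ring
    have e2 : l2norm h ^ 2 = ‖star h ⬝ᵥ h‖ := by
      rw [star_dotProduct_self, Complex.norm_real, Real.norm_of_nonneg (sq_nonneg _)]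
    rw [e2, e]
    calc _ ≤ ∑ i, ∑ j, a i * a j * (gram n d i j * (l2norm (g i) * l2norm (g j))) := by
          refine (norm_sum_le _ _).trans (Finset.sum_le_sum fun i _ => ?_)
          refine (norm_sum_le _ _).trans (Finset.sum_le_sum fun j _ => ?_)
          rw [norm_mul, norm_mul, Complex.norm_real, Complex.norm_real,
            Real.norm_of_nonneg (ha i), Real.norm_of_nonneg (ha j)]
          exact mul_le_mul_of_nonneg_left (norm_star_insertPair_dotProduct_le _ _ _ _)
            (mul_nonneg (ha i) (ha j))
      _ = ∑ i, ∑ j, √(a i) * √(a j) * gram n d i j *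
            ((√(a i) * l2norm (g i)) * (√(a j) * l2norm (g j))) := by
          refine Finset.sum_congr rfl fun i _ => Finset.sum_congr rfl fun j _ => ?_
          conv_lhs => rw [← Real.mul_self_sqrt (ha i), ← Real.mul_self_sqrt (ha j)]
          ring
      _ ≤ μ * ∑ i, (√(a i) * l2norm (g i)) ^ 2 := hμ _
      _ = μ * formS a f := by
          simp only [mul_pow, Real.sq_sqrt (ha _), formS, hg]
  have hμ0 : 0 ≤ μ * l2norm f ^ 2 := by
    refine mul_nonneg ?_ (sq_nonneg _)
    -- This test vector gives a_0 d ≤ μ, hence μ ≥ 0.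
    have := hμ (Pi.single 0 1)
    simp [Pi.single_apply, gram] at this
    refine le_trans ?_ this
    positivity
  by_contra hcon
  push Not at hcon
  have h3 : formS a f ^ 2 ≤ l2norm f ^ 2 * l2norm h ^ 2 := by
    rw [← mul_pow]
    exact pow_le_pow_left₀ hQ0 h1 2
  have h4 : l2norm f ^ 2 * l2norm h ^ 2 ≤ l2norm f ^ 2 * (μ * formS a f) :=
    mul_le_mul_of_nonneg_left h2 (sq_nonneg _)
  have h5 : 0 < formS a f := lt_of_le_of_lt hμ0 hcon
  nlinarith

theorem chiVec_eq (b : Fin (n + 1) → ℝ) (v : (Fin n → Fin d) → ℂ) :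
    chiVec b v = ∑ i, (b i : ℂ) • insertPair i v := rfl

theorem contractPair_chiVec {v : (Fin n → Fin d) → ℂ} (hv : IsPermInvariant v)
    (b : Fin (n + 1) → ℝ) (i : Fin (n + 1)) :
    contractPair i (chiVec b v) = ((∑ j, gram n d i j * b j : ℝ) : ℂ) • v := by
  have h : contractPair i (chiVec b v) = ∑ j, (b j : ℂ) • contractPair i (insertPair j v) := by
    ext z
    simp only [contractPair, chiVec_eq, Finset.sum_apply, Pi.smul_apply, Finset.smul_sum]
    exact Finset.sum_comm
  rw [h]
  simp only [hv.contractPair_insertPair, smul_smul, ← Finset.sum_smul]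
  congr 1
  push_cast
  exact Finset.sum_congr rfl fun j _ => mul_comm _ _

theorem insertPair_smul (i : Fin (n + 1)) (c : ℂ) (v : (Fin n → Fin d) → ℂ) :
    insertPair i (c • v) = c • insertPair i v := by
  ext x
  simp [insertPair_apply]

theorem matS_mulVec_chiVec {v : (Fin n → Fin d) → ℂ} (hv : IsPermInvariant v)
    (a b : Fin (n + 1) → ℝ) :
    (matS d a).mulVec (chiVec b v)
      = chiVec (fun i => a i * ∑ j, gram n d i j * b j) v := by
  simp only [matS_mulVec, contractPair_chiVec hv]
  rw [chiVec_eq]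
  refine Finset.sum_congr rfl fun i _ => ?_
  rw [insertPair_smul, smul_smul, Complex.ofReal_mul]

/-- The quadratic form of the Gram matrix. -/
def gramForm (n d : ℕ) (b : Fin (n + 1) → ℝ) : ℝ := ∑ i, b i * ∑ j, gram n d i j * b j

theorem l2norm_chiVec_sq {v : (Fin n → Fin d) → ℂ} (hv : IsPermInvariant v)
    (b : Fin (n + 1) → ℝ) : l2norm (chiVec b v) ^ 2 = gramForm n d b * l2norm v ^ 2 := by
  have h : star (chiVec b v) ⬝ᵥ chiVec b v = ((gramForm n d b * l2norm v ^ 2 : ℝ) : ℂ) := by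
    conv_lhs => rw [chiVec_eq b v]
    simp only [dotProduct_sum, dotProduct_smul, star_dotProduct_insertPair]
    rw [← chiVec_eq]
    simp only [contractPair_chiVec hv, star_smul, smul_dotProduct, star_dotProduct_self,
      Complex.star_def, Complex.conj_ofReal, gramForm, smul_eq_mul]
    push_cast
    rw [Finset.sum_mul]
    exact Finset.sum_congr rfl fun i _ => by ring
  rw [star_dotProduct_self] at h
  exact_mod_cast h

theorem formS_chiVec {v : (Fin n → Fin d) → ℂ} (hv : IsPermInvariant v)
    (a b : Fin (n + 1) → ℝ) :
    formS a (chiVec b v) = (∑ i, a i * (∑ j, gram n d i j * b j) ^ 2) * l2norm v ^ 2 := by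
  simp only [formS, contractPair_chiVec hv, Finset.sum_mul]
  refine Finset.sum_congr rfl fun i _ => ?_
  rw [l2norm, WithLp.toLp_smul, norm_smul, mul_pow, ← l2norm, Complex.norm_real, Real.norm_eq_abs,
    sq_abs]
  ring

end Pairs

/-- A symmetric real matrix with nonnegative entries has a nonnegative unit eigenvector for the
maximum of its quadratic form. -/
theorem exists_nonneg_eigenvector_of_isSymm {ι : Type*} [Fintype ι] [Nonempty ι]
    [DecidableEq ι] (K : Matrix ι ι ℝ) (hK : K.IsSymm) (hK0 : ∀ i j, 0 ≤ K i j) :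
    ∃ (μ : ℝ) (c : ι → ℝ), (∀ i, 0 ≤ c i) ∧ ∑ i, c i ^ 2 = 1 ∧ K.mulVec c = μ • c ∧
      ∀ x : ι → ℝ, x ⬝ᵥ K.mulVec x ≤ μ * ∑ i, x i ^ 2 := by
  have hcont : Continuous fun x : EuclideanSpace ℝ ι => x.ofLp ⬝ᵥ K.mulVec x.ofLp := by
    simp only [dotProduct, Matrix.mulVec]
    fun_prop
  have hne : (Metric.sphere (0 : EuclideanSpace ℝ ι) 1).Nonempty :=
    NormedSpace.sphere_nonempty.mpr zero_le_one
  obtain ⟨y, hy, hmax⟩ := (isCompact_sphere (0 : EuclideanSpace ℝ ι) 1).exists_isMaxOn hne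
    hcont.continuousOn
  have hy1 : ∑ i, y i ^ 2 = 1 := by
    have : ‖y‖ ^ 2 = 1 := by simp [mem_sphere_zero_iff_norm.mp hy]
    rw [EuclideanSpace.norm_sq_eq] at this
    simpa using this
  set μ := y.ofLp ⬝ᵥ K.mulVec y.ofLp with hμ
  have hbound : ∀ x : ι → ℝ, x ⬝ᵥ K.mulVec x ≤ μ * ∑ i, x i ^ 2 := by
    intro x
    by_cases hx : WithLp.toLp 2 x = 0
    · have : x = 0 := by simpa using hx
      simp [this]
    · have hpos : 0 < ‖WithLp.toLp 2 x‖ := norm_pos_iff.mpr hx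
      have hsq : ‖WithLp.toLp 2 x‖ ^ 2 = ∑ i, x i ^ 2 := by
        rw [EuclideanSpace.norm_sq_eq]; simp
      have h := hmax (show (‖WithLp.toLp 2 x‖⁻¹ • WithLp.toLp 2 x : EuclideanSpace ℝ ι) ∈
        Metric.sphere 0 1 by simp [norm_smul, hpos.ne'])
      simp only [Set.mem_ofPred_eq, WithLp.ofLp_smul, Matrix.mulVec_smul, dotProduct_smul,
        smul_dotProduct, smul_eq_mul, ← hμ] at h
      rw [← hsq]
      have h2 := mul_le_mul_of_nonneg_right h (sq_nonneg ‖WithLp.toLp 2 x‖)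
      calc _ = ‖WithLp.toLp 2 x‖⁻¹ * (‖WithLp.toLp 2 x‖⁻¹ * x ⬝ᵥ K.mulVec x)
            * ‖WithLp.toLp 2 x‖ ^ 2 := by field_simp
        _ ≤ _ := h2
  -- As the entries of K are nonnegative, passing to absolute values keeps the norm and cannot
  -- decrease the form, so c is again a maximizer.
  set c : ι → ℝ := fun i => |y i| with hc
  have hc1 : ∑ i, c i ^ 2 = 1 := by simpa [hc] using hy1
  have hcμ : c ⬝ᵥ K.mulVec c = μ := by
    refine le_antisymm (by simpa [hc1] using hbound c) ?_
    simp only [hμ, dotProduct, Matrix.mulVec, Finset.mul_sum]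
    refine Finset.sum_le_sum fun i _ => Finset.sum_le_sum fun j _ => ?_
    have := mul_le_mul_of_nonneg_left (le_abs_self (y i * y j)) (hK0 i j)
    rw [abs_mul] at this
    simp only [hc]
    linarith
  refine ⟨μ, c, fun i => abs_nonneg _, hc1, ?_, hbound⟩
  have hform : ∀ x : ι → ℝ, x ⬝ᵥ (μ • (1 : Matrix ι ι ℝ) - K).mulVec x
      = μ * ∑ i, x i ^ 2 - x ⬝ᵥ K.mulVec x := by
    intro x
    rw [Matrix.sub_mulVec, dotProduct_sub, Matrix.smul_mulVec, Matrix.one_mulVec, dotProduct_smul,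
      smul_eq_mul]
    simp only [dotProduct, sq]
  -- A positive semidefinite matrix annihilates the zeros of its form; applied to μ - K and c this
  -- is the eigenvector equation.
  have hpsd : (μ • (1 : Matrix ι ι ℝ) - K).PosSemidef := by
    refine Matrix.PosSemidef.of_dotProduct_mulVec_nonneg ?_ fun x => ?_
    · rw [Matrix.IsHermitian, Matrix.conjTranspose_eq_transpose_of_trivial, Matrix.transpose_sub,
        Matrix.transpose_smul, Matrix.transpose_one, hK.eq]
    · rw [star_trivial, hform]
      linarith [hbound x]
  have h0 := (hpsd.dotProduct_mulVec_zero_iff c).mp (by rw [star_trivial, hform, hc1, hcμ]; ring)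
  rw [Matrix.sub_mulVec, Matrix.smul_mulVec, Matrix.one_mulVec, sub_eq_zero] at h0
  exact h0.symm

/-! ### The largest eigenvalues of S_a and R_a -/

section TopEigenvalue

variable {n d : ℕ}

theorem exists_top_weights (hd : 1 ≤ d) {a : Fin (n + 1) → ℝ} (ha : IsDirectionVector a) :
    ∃ (μ : ℝ) (b : Fin (n + 1) → ℝ), (∀ i, 0 ≤ b i) ∧ gramForm n d b = 1 ∧
      (∀ i, a i * ∑ j, gram n d i j * b j = μ * b i) ∧
      ∀ f : (Fin (n + 2) → Fin d) → ℂ, formS a f ≤ μ * l2norm f ^ 2 := by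
  have ha0 : ∀ i, 0 ≤ a i := fun i => (ha.1 i).1
  have hg0 : ∀ i j, 0 ≤ gram n d i j := fun i j => by
    unfold gram
    split_ifs <;> positivity
  obtain ⟨μ, c, hc0, hc1, hKc, hbound⟩ := exists_nonneg_eigenvector_of_isSymm
    (Matrix.of fun i j => √(a i) * √(a j) * gram n d i j)
    (by ext i j; simp only [Matrix.transpose_apply, Matrix.of_apply, gram_comm i j]; ring)
    (fun i j => mul_nonneg (mul_nonneg (Real.sqrt_nonneg _) (Real.sqrt_nonneg _)) (hg0 i j))
  have hdR : (0 : ℝ) < d := by exact_mod_cast hd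
  have hμ : 0 < μ := by
    obtain ⟨i, -, hi⟩ := Finset.exists_ne_zero_of_sum_ne_zero (ha.2.trans_ne one_ne_zero)
    have h := hbound (Pi.single i 1)
    simp [Pi.single_apply, gram, Real.mul_self_sqrt (ha0 i)] at h
    exact lt_of_lt_of_le (mul_pos (lt_of_le_of_ne (ha0 i) hi.symm) hdR) h
  have hKc' : ∀ i, √(a i) * ∑ j, gram n d i j * (√(a j) * c j) = μ * c i := by
    intro i
    have := congrFun hKc i
    simp only [Matrix.mulVec, dotProduct, Matrix.of_apply, Pi.smul_apply, smul_eq_mul] at this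
    rw [← this, Finset.mul_sum]
    exact Finset.sum_congr rfl fun j _ => by ring
  have hsum : ∀ i, ∑ j, gram n d i j * (√(a j) * c j / √μ)
      = (∑ j, gram n d i j * (√(a j) * c j)) / √μ := fun i => by
    rw [Finset.sum_div]
    exact Finset.sum_congr rfl fun j _ => by ring
  -- With A = diag(a) and K = A^{1/2} G A^{1/2}, the equation K c = μ c turns into A G b = μ b for b
  -- = A^{1/2} c / √μ. The factor 1/√μ normalizes b · G b = c · K c / μ to 1.
  refine ⟨μ, fun i => √(a i) * c i / √μ, fun i => ?_, ?_, fun i => ?_,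
    formS_le ha0 fun x => ?_⟩
  · exact div_nonneg (mul_nonneg (Real.sqrt_nonneg _) (hc0 i)) (Real.sqrt_nonneg _)
  · have h : ∀ i, √(a i) * c i / √μ * ∑ j, gram n d i j * (√(a j) * c j / √μ) = c i ^ 2 := by
      intro i
      rw [hsum]
      calc _ = (√(a i) * ∑ j, gram n d i j * (√(a j) * c j)) * c i / (√μ * √μ) := by
            field_simp
        _ = _ := by
            rw [hKc', Real.mul_self_sqrt hμ.le]
            field_simp
    simp only [gramForm, h, hc1]
  · rw [hsum]
    calc _ = √(a i) * (√(a i) * ∑ j, gram n d i j * (√(a j) * c j)) / √μ := by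
          rw [← mul_assoc, Real.mul_self_sqrt (ha0 i)]
          ring
      _ = _ := by
          rw [hKc']
          ring
  · refine le_trans (le_of_eq ?_) (hbound x)
    simp only [dotProduct, Matrix.mulVec, Finset.mul_sum, Matrix.of_apply]
    exact Finset.sum_congr rfl fun i _ => Finset.sum_congr rfl fun j _ => by ring

theorem exists_unit_mem_symmetricSubspace (n : ℕ) (hd : 1 ≤ d) :
    ∃ v ∈ symmetricSubspace n d, star v ⬝ᵥ v = 1 := by
  refine ⟨_, Submodule.subset_span ⟨Pi.single ⟨0, hd⟩ 1, rfl⟩, ?_⟩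
  have h : (tensorVec fun _ : Fin n => (Pi.single ⟨0, hd⟩ 1 : Fin d → ℂ))
      = Pi.single (fun _ => ⟨0, hd⟩) 1 := by
    ext x
    by_cases hx : x = fun _ => ⟨0, hd⟩
    · subst hx
      simp [tensorVec]
    · rw [Pi.single_eq_of_ne hx, tensorVec]
      obtain ⟨l, hl⟩ := Function.ne_iff.mp hx
      exact Finset.prod_eq_zero (Finset.mem_univ l) (Pi.single_eq_of_ne hl 1)
  simp only [h]
  simp

theorem gramForm_of_normalized {v : (Fin n → Fin d) → ℂ} (hv : IsPermInvariant v)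
    (hv1 : star v ⬝ᵥ v = 1) (b : Fin (n + 1) → ℝ) :
    star (chiVec b v) ⬝ᵥ chiVec b v = (gramForm n d b : ℂ) := by
  rw [star_dotProduct_self] at hv1 ⊢
  rw [l2norm_chiVec_sq hv, Complex.ofReal_mul, hv1, mul_one]

theorem le_of_hasEigenvalue_matS {a : Fin (n + 1) → ℝ} {μ ν : ℝ}
    (hμ : ∀ f : (Fin (n + 2) → Fin d) → ℂ, formS a f ≤ μ * l2norm f ^ 2)
    (hν : Module.End.HasEigenvalue (Matrix.toLin' (matS d a)) (ν : ℂ)) : ν ≤ μ := by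
  obtain ⟨f, hf⟩ := hν.exists_hasEigenvector
  have h := star_dotProduct_matS_mulVec a f
  have h2 := hf.apply_eq_smul
  rw [Matrix.toLin'_apply] at h2
  rw [h2, dotProduct_smul, star_dotProduct_self, smul_eq_mul, ← Complex.ofReal_mul,
    Complex.ofReal_inj] at h
  have hpos : 0 < l2norm f := norm_pos_iff.mpr fun h0 => hf.2 (by simpa using h0)
  exact le_of_mul_le_mul_right (h.trans_le (hμ f)) (by positivity)

/-- The largest eigenvalue of `S_a`, with nonnegative weights of a top eigenvector. -/
theorem exists_isGreatest_eigenvalue_matS (hd : 1 ≤ d) {a : Fin (n + 1) → ℝ}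
    (ha : IsDirectionVector a) :
    ∃ μ : ℝ, IsGreatest {ν : ℝ | Module.End.HasEigenvalue (Matrix.toLin' (matS d a)) (ν : ℂ)} μ ∧
      (∀ f : (Fin (n + 2) → Fin d) → ℂ, formS a f ≤ μ * l2norm f ^ 2) ∧
      ∃ (b : Fin (n + 1) → ℝ) (v : (Fin n → Fin d) → ℂ), (∀ i, 0 ≤ b i) ∧
        IsTopEigenvector a b v := by
  obtain ⟨μ, b, hb0, hb1, hb, hμ⟩ := exists_top_weights hd ha
  obtain ⟨v, hv, hv1⟩ := exists_unit_mem_symmetricSubspace n hd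
  have hvp := isPermInvariant_of_mem hv
  have hnorm : star (chiVec b v) ⬝ᵥ chiVec b v = 1 := by
    rw [gramForm_of_normalized hvp hv1, hb1, Complex.ofReal_one]
  have heig : (matS d a).mulVec (chiVec b v) = (μ : ℂ) • chiVec b v := by
    rw [matS_mulVec_chiVec hvp]
    simp only [hb, chiVec, Finset.smul_sum, smul_smul, Complex.ofReal_mul]
  have hgr : IsGreatest {ν : ℝ | Module.End.HasEigenvalue (Matrix.toLin' (matS d a)) (ν : ℂ)} μ := by
    refine ⟨?_, fun ν hν => le_of_hasEigenvalue_matS hμ hν⟩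
    refine Module.End.hasEigenvalue_of_hasEigenvector (x := chiVec b v)
      (Module.End.hasEigenvector_iff.mpr ⟨?_, fun h => ?_⟩)
    · rw [Module.End.mem_eigenspace_iff, Matrix.toLin'_apply, heig]
    · rw [h] at hnorm
      simp at hnorm
  refine ⟨μ, hgr, hμ, b, v, hb0, hv, hv1, hnorm, ?_⟩
  -- The supremum defining `maxEigenvalue` is attained, so no default value of `sSup` enters.
  rw [heig, maxEigenvalue, hgr.csSup_eq]

theorem matR_eq (a : Fin (n + 1) → ℝ) (ha : ∑ i, a i = 1) : matR d a = 1 + matS d a := by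
  have h1 : ∀ i : Fin (n + 1), onPair (n := n) (((d : ℂ) ^ 2) • maxMixedState d) i = 1 := by
    intro i
    ext x y
    have hd : (d : ℂ) ≠ 0 := by
      have := (x 0).pos
      exact_mod_cast this.ne'
    have hxy : x = y ↔ (x 0, x i.succ) = (y 0, y i.succ) ∧
        ∀ j, x (i.succAbove j).succ = y (i.succAbove j).succ := by
      constructor
      · rintro rfl
        simp
      · rintro ⟨h, h'⟩
        simp only [Prod.mk.injEq] at h
        ext l
        refine congrArg _ ?_
        refine Fin.cases h.1 (fun k => ?_) l
        rcases Fin.eq_self_or_eq_succAbove i k with rfl | ⟨j, rfl⟩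
        · exact h.2
        · exact h' j
    simp only [onPair, maxMixedState, Matrix.of_apply, Matrix.smul_apply, Matrix.one_apply,
      smul_eq_mul, hxy, ite_and, mul_ite, mul_one, mul_zero]
    rw [mul_inv_cancel₀ (pow_ne_zero 2 hd)]
    split_ifs <;> rfl
  have h2 : ∀ (A B : Matrix (Fin d × Fin d) (Fin d × Fin d) ℂ) (i : Fin (n + 1)),
      onPair (n := n) (A + B) i = onPair A i + onPair B i := by
    intro A B i
    ext x y
    simp only [onPair, Matrix.of_apply, Matrix.add_apply, add_mul]
  simp only [matR, matS, h2, h1, smul_add, Finset.sum_add_distrib, ← Finset.sum_smul]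
  rw [← Complex.ofReal_sum, ha, Complex.ofReal_one, one_smul]

theorem maxEigenvalue_matR {a : Fin (n + 1) → ℝ} (ha : ∑ i, a i = 1) {μ : ℝ}
    (hμ : IsGreatest {ν : ℝ | Module.End.HasEigenvalue (Matrix.toLin' (matS d a)) (ν : ℂ)} μ) :
    maxEigenvalue (matR d a) = 1 + μ := by
  have h : ∀ ν : ℝ, Module.End.HasEigenvalue (Matrix.toLin' (matR d a)) (ν : ℂ)
      ↔ Module.End.HasEigenvalue (Matrix.toLin' (matS d a)) ((ν - 1 : ℝ) : ℂ) := by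
    intro ν
    have he : Module.End.eigenspace (Matrix.toLin' (matR d a)) (ν : ℂ)
        = Module.End.eigenspace (Matrix.toLin' (matS d a)) ((ν - 1 : ℝ) : ℂ) := by
      ext f
      rw [Module.End.mem_eigenspace_iff, Module.End.mem_eigenspace_iff, matR_eq a ha,
        Matrix.toLin'_apply, Matrix.toLin'_apply, Matrix.add_mulVec, Matrix.one_mulVec,
        Complex.ofReal_sub, Complex.ofReal_one, sub_smul, one_smul, eq_sub_iff_add_eq, add_comm f]
    rw [Module.End.hasEigenvalue_iff, Module.End.hasEigenvalue_iff, he]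
  refine IsGreatest.csSup_eq ⟨?_, fun ν hν => ?_⟩
  · rw [Set.mem_ofPred_eq, h, add_sub_cancel_left]
    exact hμ.1
  · have := hμ.2 ((h ν).mp hν)
    linarith

end TopEigenvalue

/-! ### The symmetric projector and its columns -/

section Projector

variable {k d : ℕ}

theorem permRep_mul (σ τ : Equiv.Perm (Fin k)) :
    (permRep σ : TensorMat k d) * permRep τ = permRep (σ * τ) := by
  ext x z
  simp only [permRep, Matrix.mul_apply, Matrix.of_apply, mul_ite, mul_one, mul_zero]
  rw [Finset.sum_ite_eq']
  simp only [Finset.mem_univ, if_true]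
  rfl

theorem conjTranspose_permRep (σ : Equiv.Perm (Fin k)) :
    (permRep σ : TensorMat k d).conjTranspose = permRep σ⁻¹ := by
  ext x y
  simp only [permRep, Matrix.conjTranspose_apply, Matrix.of_apply, apply_ite star, star_one,
    star_zero]
  refine if_congr ?_ rfl rfl
  constructor
  · rintro rfl
    ext l
    simp [Equiv.Perm.inv_def]
  · rintro rfl
    ext l
    simp [Equiv.Perm.inv_def]

theorem conjTranspose_symProjector :
    (symProjector k d).conjTranspose = symProjector k d := by
  rw [symProjector, Matrix.conjTranspose_smul, Matrix.conjTranspose_sum]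
  simp only [conjTranspose_permRep, ← Equiv.inv_apply]
  rw [Equiv.sum_comp (Equiv.inv (Equiv.Perm (Fin k))) fun σ => (permRep σ : TensorMat k d)]
  simp

theorem permRep_mul_symProjector (σ : Equiv.Perm (Fin k)) :
    permRep σ * symProjector k d = symProjector k d := by
  rw [symProjector, Matrix.mul_smul, Matrix.mul_sum]
  simp only [permRep_mul, ← Equiv.coe_mulLeft]
  rw [Equiv.sum_comp (Equiv.mulLeft σ) fun τ => (permRep τ : TensorMat k d)]

theorem symProjector_mul_self : symProjector k d * symProjector k d = symProjector k d := by
  conv_lhs => rw [symProjector]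
  rw [Matrix.smul_mul, Matrix.sum_mul]
  rw [show (((k.factorial : ℂ)⁻¹) • ∑ σ : Equiv.Perm (Fin k), permRep σ : TensorMat k d)
    = symProjector k d from rfl]
  simp only [permRep_mul_symProjector, Finset.sum_const, Finset.card_univ, Fintype.card_perm,
    Fintype.card_fin]
  rw [← Nat.cast_smul_eq_nsmul ℂ, smul_smul, inv_mul_cancel₀, one_smul]
  exact_mod_cast k.factorial_ne_zero

/-- The columns of the projector onto the symmetric subspace. -/
noncomputable def symColumn (z : Fin k → Fin d) : (Fin k → Fin d) → ℂ :=
  fun y => symProjector k d y z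

theorem isPermInvariant_symColumn (z : Fin k → Fin d) : IsPermInvariant (symColumn z) := by
  intro π y
  have h := congrFun (congrFun (permRep_mul_symProjector (d := d) π) y) z
  rw [symColumn, symColumn, ← h]
  simp only [Matrix.mul_apply, permRep, Matrix.of_apply, ite_mul, one_mul, zero_mul]
  rw [Finset.sum_eq_single (y ∘ π)]
  · rw [if_pos]
    ext l
    simp
  · rintro w - hw
    rw [if_neg]
    rintro rfl
    exact hw (by ext l; simp)
  · simp

/-- The rank of the projector onto the symmetric subspace. -/
noncomputable def symTrace (k d : ℕ) : ℝ := ∑ z : Fin k → Fin d, l2norm (symColumn z) ^ 2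

/-- From P⁺ = (P⁺)^* P⁺, the trace is the sum of the squared norms of the columns. -/
theorem trace_symProjector : (symProjector k d).trace = (symTrace k d : ℂ) := by
  conv_lhs => rw [← symProjector_mul_self]
  conv_lhs => enter [1, 1]; rw [← conjTranspose_symProjector]
  simp only [symTrace, Complex.ofReal_sum, ← star_dotProduct_self]
  rfl

theorem symTrace_pos (k : ℕ) (hd : 1 ≤ d) : 0 < symTrace k d := by
  refine Finset.sum_pos' (fun z _ => sq_nonneg _) ⟨fun _ => ⟨0, hd⟩, Finset.mem_univ _, ?_⟩
  refine pow_pos (norm_pos_iff.mpr fun h => ?_) 2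
  have h1 : symColumn (k := k) (fun _ => (⟨0, hd⟩ : Fin d)) = 0 := by simpa using h
  have h2 := congrFun h1 fun _ => ⟨0, hd⟩
  have h3 : ∀ σ : Equiv.Perm (Fin k), (fun _ => ⟨0, hd⟩ : Fin k → Fin d)
      = (fun _ => ⟨0, hd⟩) ∘ σ.symm := fun σ => rfl
  simp only [symColumn, symProjector, Matrix.smul_apply, Matrix.sum_apply, permRep,
    Matrix.of_apply, if_pos (h3 _), Finset.sum_const, Finset.card_univ, Fintype.card_perm,
    Fintype.card_fin, nsmul_eq_mul, mul_one, smul_eq_mul, Pi.zero_apply] at h2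
  rw [inv_mul_cancel₀ (by exact_mod_cast k.factorial_ne_zero)] at h2
  exact one_ne_zero h2

end Projector

/-! ### Columns and symmetries of P^a -/

section Weighted

variable {n d : ℕ}

theorem sum_cons {M : Type*} [AddCommMonoid M] (F : (Fin (n + 1) → Fin d) → M) :
    ∑ x, F x = ∑ r : Fin d, ∑ z : Fin n → Fin d, F (Fin.cons r z) := by
  rw [← (Fin.consEquiv fun _ : Fin (n + 1) => Fin d).sum_comp, Fintype.sum_prod_type]
  rfl

theorem weightedProjector_apply (b : Fin (n + 1) → ℝ) (x y : Fin (n + 1) → Fin d) :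
    weightedProjector d b x y = ((n + 1).factorial : ℂ)⁻¹ *
      ∑ σ : Equiv.Perm (Fin (n + 1)), if y = x ∘ σ then (b (σ 0) : ℂ) else 0 := by
  simp only [weightedProjector, Matrix.smul_apply, Matrix.sum_apply, permRep, Matrix.of_apply,
    smul_eq_mul, mul_ite, mul_one, mul_zero]
  congr 1
  refine Finset.sum_congr rfl fun σ _ => if_congr ?_ rfl rfl
  constructor
  · rintro rfl
    ext l
    simp
  · rintro rfl
    ext l
    simp

theorem symColumn_apply (z y : Fin n → Fin d) :
    symColumn z y = (n.factorial : ℂ)⁻¹ *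
      ∑ σ : Equiv.Perm (Fin n), if z = y ∘ σ then (1 : ℂ) else 0 := by
  simp only [symColumn, symProjector, Matrix.smul_apply, Matrix.sum_apply, permRep,
    Matrix.of_apply, smul_eq_mul]
  congr 1
  refine Finset.sum_congr rfl fun σ _ => if_congr ?_ rfl rfl
  constructor
  · rintro rfl
    ext l
    simp
  · rintro rfl
    ext l
    simp

/-- The columns of `P^a` are the vectors `χ` built from the columns of the projector onto the
symmetric subspace of the remaining factors. -/
theorem weightedProjector_cons (b : Fin (n + 1) → ℝ) (x : Fin (n + 1) → Fin d) (r : Fin d)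
    (z : Fin n → Fin d) :
    weightedProjector d b x (Fin.cons r z)
      = ((n : ℂ) + 1)⁻¹ * chiVec b (symColumn z) (Fin.cons r x) := by
  have hfac : ((n + 1).factorial : ℂ)⁻¹ = ((n : ℂ) + 1)⁻¹ * (n.factorial : ℂ)⁻¹ := by
    rw [Nat.factorial_succ, Nat.cast_mul, mul_inv]
    push_cast
    rfl
  have hsum : ∀ i : Fin (n + 1), ∑ e : Equiv.Perm (Fin n),
      (if (Fin.cons r z : Fin (n + 1) → Fin d) = x ∘ (Equiv.Perm.decomposeFin.symm (i, e)) then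
        (b ((Equiv.Perm.decomposeFin.symm (i, e)) 0) : ℂ) else 0)
      = (b i : ℂ) * (if r = x i then (∑ e : Equiv.Perm (Fin n),
        if z = (fun j => x (i.succAbove j)) ∘ e then (1 : ℂ) else 0) else 0) := by
    intro i
    -- The permutations with σ 0 = i are indexed by e, but `decomposeFin` orders the remaining
    -- copies through the swap of 0 and i, whereas χ lists them increasingly. The discrepancy π is
    -- absorbed by reindexing the sum over e.
    obtain ⟨π, hπ⟩ := exists_perm_swap_succAbove i 0
    rw [← Equiv.sum_comp (Equiv.mulLeft π) fun e : Equiv.Perm (Fin n) =>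
      if z = (fun j => x (i.succAbove j)) ∘ e then (1 : ℂ) else 0]
    have hiff : ∀ e : Equiv.Perm (Fin n),
        (Fin.cons r z : Fin (n + 1) → Fin d) = x ∘ (Equiv.Perm.decomposeFin.symm (i, e)) ↔
        r = x i ∧ z = (fun j => x (i.succAbove j)) ∘ (Equiv.mulLeft π e : Equiv.Perm (Fin n)) := by
      intro e
      have hs : ∀ l : Fin n, Equiv.Perm.decomposeFin.symm (i, e) l.succ
          = i.succAbove (π (e l)) := by
        intro l
        rw [Equiv.Perm.decomposeFin_symm_apply_succ, ← hπ, Equiv.swap_comm, Fin.succAbove_zero]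
      constructor
      · intro h
        refine ⟨by simpa using congrFun h 0, funext fun l => ?_⟩
        have := congrFun h l.succ
        rwa [Fin.cons_succ, Function.comp_apply, hs] at this
      · rintro ⟨h1, h2⟩
        funext l
        refine Fin.cases ?_ (fun l => ?_) l
        · simpa using h1
        · rw [Fin.cons_succ, Function.comp_apply, hs, h2]
          rfl
    simp only [hiff, ite_and, Equiv.Perm.decomposeFin_symm_apply_zero]
    split_ifs
    · rw [Finset.mul_sum]
      exact Finset.sum_congr rfl fun e _ => by rw [mul_ite, mul_one, mul_zero]
    · simp
  rw [weightedProjector_apply, ← Equiv.Perm.decomposeFin.symm.sum_comp, Fintype.sum_prod_type]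
  simp only [hsum]
  simp only [chiVec_eq, Finset.sum_apply, Pi.smul_apply, insertPair_apply, Fin.cons_zero,
    Fin.cons_succ, symColumn_apply, smul_eq_mul, Finset.mul_sum, hfac]
  refine Finset.sum_congr rfl fun i _ => ?_
  split_ifs
  · simp only [Finset.mul_sum]
    refine Finset.sum_congr rfl fun e _ => ?_
    ring
  · simp

theorem weightedProjector_one : weightedProjector d (fun _ : Fin (n + 1) => 1)
    = symProjector (n + 1) d := by
  simp [weightedProjector, symProjector]

theorem gramForm_one (n d : ℕ) : gramForm n d (fun _ => 1) = (n + 1) * (n + d) := by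
  have h : ∀ i j : Fin (n + 1), gram n d i j = 1 + (if i = j then (d : ℝ) - 1 else 0) := by
    intro i j
    unfold gram
    split_ifs <;> ring
  simp only [gramForm, h, mul_one, one_mul, Finset.sum_add_distrib, Finset.sum_ite_eq,
    Finset.mem_univ, if_true, Finset.sum_const, Finset.card_univ, Fintype.card_fin, nsmul_eq_mul]
  push_cast
  ring

theorem l2norm_sq {ι : Type*} [Fintype ι] (f : ι → ℂ) : l2norm f ^ 2 = ∑ i, ‖f i‖ ^ 2 := by
  rw [l2norm, EuclideanSpace.norm_sq_eq]

theorem l2norm_smul_sq {ι : Type*} [Fintype ι] (c : ℝ) (f : ι → ℂ) :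
    l2norm ((c : ℂ) • f) ^ 2 = c ^ 2 * l2norm f ^ 2 := by
  simp [l2norm_sq, mul_pow, Finset.mul_sum]

/-- For b = 1 the matrix P^a is P⁺ itself, so the columns of the larger projector are (n + 1)⁻¹ χ,
and `gramForm_one` gives the norms. This recursion is what explains the normalizing constant of the
cloner. -/
theorem symTrace_succ (n d : ℕ) :
    symTrace (n + 1) d = (n + d) / (n + 1) * symTrace n d := by
  have h : ∀ r : Fin d, ∀ z : Fin n → Fin d, ∀ x : Fin (n + 1) → Fin d,
      symColumn (Fin.cons r z : Fin (n + 1) → Fin d) x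
        = ((n : ℂ) + 1)⁻¹ * chiVec (fun _ => 1) (symColumn z) (Fin.cons r x) := by
    intro r z x
    rw [← weightedProjector_cons, weightedProjector_one]
    rfl
  have hn : ‖((n : ℂ) + 1)⁻¹‖ = ((n : ℝ) + 1)⁻¹ := by
    rw [norm_inv]
    norm_cast
  have hz : ∀ z : Fin n → Fin d, ∑ r : Fin d, ∑ x : Fin (n + 1) → Fin d,
      ‖chiVec (fun _ => 1) (symColumn z) (Fin.cons r x)‖ ^ 2
        = (n + 1) * (n + d) * l2norm (symColumn z) ^ 2 := by
    intro z
    rw [← gramForm_one, ← l2norm_chiVec_sq (isPermInvariant_symColumn z), l2norm_sq, sum_cons]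
  rw [symTrace, sum_cons]
  simp only [l2norm_sq (symColumn (Fin.cons _ _)), h, norm_mul, mul_pow, hn, ← Finset.mul_sum]
  rw [Finset.sum_comm]
  simp only [hz, ← Finset.mul_sum]
  rw [← symTrace]
  field_simp

theorem weightedProjector_relabel (b : Fin (n + 1) → ℝ) (π : Equiv.Perm (Fin d))
    (x y : Fin (n + 1) → Fin d) :
    weightedProjector d b (π ∘ x) (π ∘ y) = weightedProjector d b x y := by
  simp only [weightedProjector_apply, Function.comp_assoc]
  congr 1
  refine Finset.sum_congr rfl fun σ _ => if_congr ?_ rfl rfl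
  exact π.injective.comp_left.eq_iff

/-- P^a only permutes letters, so the sum of the letters is conserved. This single integer suffices
to separate the matrix units in the trace computation. -/
theorem sum_eq_of_weightedProjector_ne_zero {b : Fin (n + 1) → ℝ} {x y : Fin (n + 1) → Fin d}
    (h : weightedProjector d b x y ≠ 0) : ∑ l, (y l : ℕ) = ∑ l, (x l : ℕ) := by
  rw [weightedProjector_apply] at h
  obtain ⟨σ, -, hσ⟩ := Finset.exists_ne_zero_of_sum_ne_zero (right_ne_zero_of_mul h)
  have : y = x ∘ σ := by
    by_contra hne
    exact hσ (if_neg hne)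
  rw [this]
  exact Equiv.sum_comp σ fun l => (x l : ℕ)

end Weighted

/-! ### Choi vectors of completely positive maps -/

section Kraus

open scoped ComplexOrder MatrixOrder

variable {n d : ℕ} {κ : Type} [Fintype κ]

/-- The vectors `f k` give a decomposition of the Choi matrix of `Φ` into rank one matrices. -/
def IsKrausFamily (Φ : Matrix (Fin d) (Fin d) ℂ →ₗ[ℂ] TensorMat (n + 1) d)
    (f : κ → (Fin (n + 2) → Fin d) → ℂ) : Prop :=
  ∀ r s x y, Φ (Matrix.single r s 1) x y = ∑ k, f k (Fin.cons r x) * star (f k (Fin.cons s y))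

variable {Φ : Matrix (Fin d) (Fin d) ℂ →ₗ[ℂ] TensorMat (n + 1) d}

theorem IsKrausFamily.posSemidef_partialApply {f : κ → (Fin (n + 2) → Fin d) → ℂ}
    (hf : IsKrausFamily Φ f) (D : ℕ) (X : Matrix (Fin d × Fin D) (Fin d × Fin D) ℂ)
    (hX : X.PosSemidef) : (partialApply Φ D X).PosSemidef := by
  set W : κ → Matrix ((Fin (n + 1) → Fin d) × Fin D) (Fin d × Fin D) ℂ := fun k =>
    Matrix.of fun p q => if p.2 = q.2 then f k (Fin.cons q.1 p.1) else 0 with hW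
  -- W k is the Kraus operator of f k tensored with the identity of the ancilla.
  have h : partialApply Φ D X = ∑ k, W k * X * (W k).conjTranspose := by
    ext ⟨x, p⟩ ⟨y, q⟩
    simp only [partialApply, Matrix.of_apply, Matrix.sum_apply, Matrix.mul_apply,
      Matrix.conjTranspose_apply, hW, Fintype.sum_prod_type, ite_mul, zero_mul,
      apply_ite star, star_zero, mul_ite, mul_zero, Finset.sum_ite_eq, Finset.mem_univ, if_true]
    rw [map_apply_eq_sum]
    simp only [Matrix.of_apply, hf _ _ _ _, Finset.mul_sum, Finset.sum_mul]
    rw [Finset.sum_comm]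
    conv_rhs => rw [Finset.sum_comm]
    refine Finset.sum_congr rfl fun s _ => ?_
    rw [Finset.sum_comm]
    refine Finset.sum_congr rfl fun k _ => Finset.sum_congr rfl fun r _ => ?_
    ring
  rw [h]
  exact Matrix.posSemidef_sum _ fun k _ => hX.mul_mul_conjTranspose_same _

/-- Applying the map to half of the unnormalized maximally entangled state `w` gives a positive Choi
matrix. Writing it as B^* B, the conjugated rows of B are the required vectors. -/
theorem IsQuantumChannel.exists_isKrausFamily (hΦ : IsQuantumChannel Φ) :
    ∃ f : ((Fin (n + 1) → Fin d) × Fin d) → (Fin (n + 2) → Fin d) → ℂ, IsKrausFamily Φ f := by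
  set w : Fin d × Fin d → ℂ := fun p => if p.1 = p.2 then 1 else 0 with hw
  have h := hΦ.completelyPositive d _ (Matrix.posSemidef_vecMulVec_self_star w)
  obtain ⟨B, hB⟩ := CStarAlgebra.nonneg_iff_eq_star_mul_self.mp h.nonneg
  refine ⟨fun k x => star (B k (Fin.tail x, x 0)), fun r s x y => ?_⟩
  have h2 := congrFun (congrFun hB (x, r)) (y, s)
  have h3 : (Matrix.of fun i j : Fin d => Matrix.vecMulVec w (star w) (i, r) (j, s))
      = Matrix.single r s 1 := by
    ext i j
    simp only [hw, Matrix.of_apply, Matrix.vecMulVec_apply, Pi.star_apply, Matrix.single_apply,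
      apply_ite star, star_one, star_zero, mul_ite, mul_one, mul_zero, eq_comm (a := r),
      eq_comm (a := s), ite_and]
    split_ifs <;> rfl
  rw [partialApply, Matrix.of_apply, h3, Matrix.mul_apply] at h2
  rw [h2]
  simp [Fin.tail_def]

theorem IsKrausFamily.sum_trace {f : κ → (Fin (n + 2) → Fin d) → ℂ} (hf : IsKrausFamily Φ f) :
    ∑ r, (Φ (Matrix.single r r 1)).trace = ((∑ k, l2norm (f k) ^ 2 : ℝ) : ℂ) := by
  simp only [Complex.ofReal_sum, ← star_dotProduct_self, dotProduct, sum_cons (n := n + 1),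
    Matrix.trace, Matrix.diag_apply, hf _ _ _ _, Pi.star_apply]
  conv_rhs => rw [Finset.sum_comm]
  refine Finset.sum_congr rfl fun r _ => ?_
  rw [Finset.sum_comm]
  exact Finset.sum_congr rfl fun k _ => Finset.sum_congr rfl fun x _ => mul_comm _ _

/-- The overlap is the pairing of the Choi matrix with d ω on systems 0 and i, and that operator is
`insertPair i` composed with its adjoint `contractPair i`. -/
theorem IsKrausFamily.entanglementOverlap_eq {f : κ → (Fin (n + 2) → Fin d) → ℂ}
    (hf : IsKrausFamily Φ f) (i : Fin (n + 1)) :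
    entanglementOverlap Φ i = ((∑ k, l2norm (contractPair i (f k)) ^ 2 : ℝ) : ℂ) := by
  simp only [Complex.ofReal_sum, ← star_dotProduct_self, dotProduct, entanglementOverlap, marginal,
    Matrix.of_apply, hf _ _ _ _, Pi.star_apply, contractPair, star_sum, Finset.sum_mul_sum]
  calc _ = ∑ x, ∑ k, ∑ y, ∑ z : Fin n → Fin d, f k (Fin.cons x (Fin.insertNth i x z))
        * star (f k (Fin.cons y (Fin.insertNth i y z))) := by
        refine Finset.sum_congr rfl fun x _ => ?_
        conv_rhs => rw [Finset.sum_comm]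
        exact Finset.sum_congr rfl fun y _ => Finset.sum_comm
    _ = _ := by
        rw [Finset.sum_comm]
        refine Finset.sum_congr rfl fun k _ => ?_
        rw [Finset.sum_comm]
        conv_rhs => rw [Finset.sum_comm]
        refine Finset.sum_congr rfl fun y _ => ?_
        rw [Finset.sum_comm]
        refine Finset.sum_congr rfl fun z _ => Finset.sum_congr rfl fun x _ => mul_comm _ _

theorem IsKrausFamily.sum_entanglementOverlap {f : κ → (Fin (n + 2) → Fin d) → ℂ}
    (hf : IsKrausFamily Φ f) (a : Fin (n + 1) → ℝ) :
    ∑ i, a i * (entanglementOverlap Φ i).re = ∑ k, formS a (f k) := by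
  simp only [hf.entanglementOverlap_eq, Complex.ofReal_re, formS, Finset.mul_sum]
  exact Finset.sum_comm

theorem IsQuantumChannel.sum_l2norm_sq (hΦ : IsQuantumChannel Φ)
    {f : κ → (Fin (n + 2) → Fin d) → ℂ} (hf : IsKrausFamily Φ f) :
    ∑ k, l2norm (f k) ^ 2 = d := by
  have h := hf.sum_trace
  simp only [hΦ.tracePreserving, Matrix.trace_single_eq_same, Finset.sum_const, Finset.card_univ,
    Fintype.card_fin, nsmul_eq_mul, mul_one] at h
  exact_mod_cast h.symm

end Kraus

/-! ### The optimal cloner is a channel -/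

section OptimalCloner

variable {n d : ℕ}

theorem optCloner_single (b : Fin (n + 1) → ℝ) (r s : Fin d) (x y : Fin (n + 1) → Fin d) :
    optCloner d b (Matrix.single r s 1) x y
      = ((d : ℂ) * ((n : ℂ) + 1) * ((n : ℂ) + d) / (symProjector (n + 1) d).trace) *
        ∑ z : Fin n → Fin d, weightedProjector d b x (Fin.cons r z)
          * star (weightedProjector d b y (Fin.cons s z)) := by
  change ((_ : ℂ) • (weightedProjector d b * padInput n d (Matrix.single r s 1) *
    (weightedProjector d b).conjTranspose) : TensorMat (n + 1) d) x y = _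
  rw [Matrix.smul_apply, smul_eq_mul]
  congr 1
  have hpad : ∀ (p q : Fin d) (u w : Fin n → Fin d),
      padInput n d (Matrix.single r s 1) (Fin.cons p u) (Fin.cons q w)
        = if r = p then (if s = q then (if u = w then 1 else 0) else 0) else 0 := by
    intro p q u w
    rw [padInput_apply]
    simp only [Fin.cons_zero, Fin.cons_succ, Matrix.single_apply, Matrix.one_apply,
      Fintype.prod_boole, ← funext_iff, ite_and, mul_ite, mul_one, mul_zero]
    split_ifs <;> rfl
  simp only [Matrix.mul_apply, sum_cons, hpad, mul_ite, mul_one, mul_zero,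
    Matrix.conjTranspose_apply]
  simp [Finset.sum_ite_irrel, Finset.sum_ite_eq]

/-- The normalized top eigenvectors that decompose the Choi matrix of the optimal cloner. -/
noncomputable def clonerKraus (b : Fin (n + 1) → ℝ) (z : Fin n → Fin d) :
    (Fin (n + 2) → Fin d) → ℂ :=
  ((√(d / symTrace n d) : ℝ) : ℂ) • chiVec b (symColumn z)

theorem isKrausFamily_clonerKraus (hd : 1 ≤ d) (b : Fin (n + 1) → ℝ) :
    IsKrausFamily (optCloner d b) (clonerKraus b) := by
  intro r s x y
  have hT := symTrace_pos n hd
  have hs : ((√(d / symTrace n d) : ℝ) : ℂ) * ((√(d / symTrace n d) : ℝ) : ℂ)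
      = (d : ℂ) / (symTrace n d : ℂ) := by
    rw [← Complex.ofReal_mul, Real.mul_self_sqrt (by positivity)]
    push_cast
    rfl
  -- The two factors 1/(n + 1) come from the columns of P^a and of its adjoint; the trace recursion
  -- reduces the constant to d divided by the trace of the projector on n factors.
  have hc : ((d : ℂ) * ((n : ℂ) + 1) * ((n : ℂ) + d) / (symProjector (n + 1) d).trace)
      * (((n : ℂ) + 1)⁻¹ * ((n : ℂ) + 1)⁻¹) = (d : ℂ) / (symTrace n d : ℂ) := by
    have h1 : (symTrace n d : ℂ) ≠ 0 := by exact_mod_cast hT.ne'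
    have h2 : (n : ℂ) + 1 ≠ 0 := by exact_mod_cast Nat.succ_ne_zero n
    have h3 : (n : ℂ) + d ≠ 0 := by
      have : n + d ≠ 0 := by omega
      exact_mod_cast this
    rw [trace_symProjector, symTrace_succ]
    push_cast
    field_simp
  rw [optCloner_single, Finset.mul_sum]
  refine Finset.sum_congr rfl fun z _ => ?_
  simp only [weightedProjector_cons, clonerKraus, Pi.smul_apply, smul_eq_mul, star_mul',
    Complex.star_def, Complex.conj_ofReal, map_inv₀, map_add, map_natCast, map_one]
  calc _ = ((d : ℂ) * ((n : ℂ) + 1) * ((n : ℂ) + d) / (symProjector (n + 1) d).trace)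
      * (((n : ℂ) + 1)⁻¹ * ((n : ℂ) + 1)⁻¹) * (chiVec b (symColumn z) (Fin.cons r x)
        * (starRingEnd ℂ) (chiVec b (symColumn z) (Fin.cons s y))) := by ring
    _ = _ := by
      rw [hc, ← hs]
      ring

theorem sum_l2norm_clonerKraus (hd : 1 ≤ d) {b : Fin (n + 1) → ℝ} (hb : gramForm n d b = 1) :
    ∑ z : Fin n → Fin d, l2norm (clonerKraus b z) ^ 2 = d := by
  have hT := symTrace_pos n hd
  simp only [clonerKraus, l2norm_smul_sq, l2norm_chiVec_sq (isPermInvariant_symColumn _), hb,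
    one_mul, ← Finset.mul_sum]
  rw [← symTrace, Real.sq_sqrt (by positivity)]
  field_simp

/-- A nonzero term would need a word x with the same letter sum as both (r, z) and (s, z), forcing r
= s. -/
theorem trace_optCloner_single_of_ne (b : Fin (n + 1) → ℝ) {r s : Fin d} (hrs : r ≠ s) :
    (optCloner d b (Matrix.single r s 1)).trace = 0 := by
  refine Finset.sum_eq_zero fun x _ => ?_
  rw [Matrix.diag_apply, optCloner_single, Finset.sum_eq_zero, mul_zero]
  intro z _
  by_contra h
  have h1 := sum_eq_of_weightedProjector_ne_zero (left_ne_zero_of_mul h)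
  have h2 := sum_eq_of_weightedProjector_ne_zero (star_ne_zero.mp (right_ne_zero_of_mul h))
  rw [Fin.sum_univ_succ] at h1 h2
  simp only [Fin.cons_zero, Fin.cons_succ] at h1 h2
  exact hrs (Fin.ext (by omega))

/-- P^a is unchanged when the basis is relabelled by the transposition of r and s. -/
theorem trace_optCloner_single_eq (b : Fin (n + 1) → ℝ) (r s : Fin d) :
    (optCloner d b (Matrix.single r r 1)).trace = (optCloner d b (Matrix.single s s 1)).trace := by
  have hcons : ∀ z : Fin n → Fin d, (Fin.cons s (Equiv.swap r s ∘ z) : Fin (n + 1) → Fin d)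
      = Equiv.swap r s ∘ (Fin.cons r z : Fin (n + 1) → Fin d) := by
    intro z
    ext l
    refine Fin.cases ?_ (fun l => ?_) l <;> simp
  simp only [Matrix.trace, Matrix.diag_apply, optCloner_single, ← Finset.mul_sum]
  congr 1
  rw [← Equiv.sum_comp (Equiv.arrowCongr (Equiv.refl (Fin (n + 1))) (Equiv.swap r s)) fun x =>
    ∑ z : Fin n → Fin d, weightedProjector d b x (Fin.cons s z)
      * star (weightedProjector d b x (Fin.cons s z))]
  refine Finset.sum_congr rfl fun x _ => ?_
  rw [← Equiv.sum_comp (Equiv.arrowCongr (Equiv.refl (Fin n)) (Equiv.swap r s)) fun z =>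
    weightedProjector d b _ (Fin.cons s z) * star (weightedProjector d b _ (Fin.cons s z))]
  refine Finset.sum_congr rfl fun z _ => ?_
  have h := weightedProjector_relabel b (Equiv.swap r s) x (Fin.cons r z)
  rw [← hcons] at h
  rw [← h]
  rfl

theorem isQuantumChannel_optCloner (hd : 1 ≤ d) {b : Fin (n + 1) → ℝ}
    (hb : gramForm n d b = 1) : IsQuantumChannel (optCloner (n := n) d b) where
  completelyPositive := (isKrausFamily_clonerKraus hd b).posSemidef_partialApply
  tracePreserving X := by
    have hd0 : (d : ℂ) ≠ 0 := by exact_mod_cast (Nat.one_le_iff_ne_zero.mp hd)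
    -- The d diagonal traces are equal, and they add up to the total squared norm d of the Choi
    -- vectors.
    have h1 : ∀ r : Fin d, (optCloner (n := n) d b (Matrix.single r r 1)).trace = 1 := by
      intro r
      have h := (isKrausFamily_clonerKraus hd b).sum_trace
      rw [sum_l2norm_clonerKraus hd hb] at h
      simp only [trace_optCloner_single_eq b _ r, Finset.sum_const, Finset.card_univ,
        Fintype.card_fin, nsmul_eq_mul, Complex.ofReal_natCast] at h
      exact mul_left_cancel₀ hd0 (h.trans (mul_one _).symm)
    have h2 : ∀ r s : Fin d, (optCloner (n := n) d b (Matrix.single r s 1)).trace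
        = if r = s then 1 else 0 := by
      intro r s
      split_ifs with h
      · rw [h, h1]
      · exact trace_optCloner_single_of_ne b h
    calc (optCloner (n := n) d b X).trace
        = ∑ r, ∑ s, X r s * (optCloner (n := n) d b (Matrix.single r s 1)).trace := by
          simp only [Matrix.trace, Matrix.diag_apply, map_apply_eq_sum (optCloner d b) X,
            Finset.mul_sum]
          rw [Finset.sum_comm]
          refine Finset.sum_congr rfl fun r _ => ?_
          rw [Finset.sum_comm]
      _ = X.trace := by
          simp only [h2]
          simp [Matrix.trace]

end OptimalCloner

/-! ### The optimal value and its attainment -/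

section Performance

variable {n d : ℕ}

theorem performance_le (hd : 1 ≤ d) {a : Fin (n + 1) → ℝ} (ha : ∑ i, a i = 1) {μ : ℝ}
    (hμ : ∀ f : (Fin (n + 2) → Fin d) → ℂ, formS a f ≤ μ * l2norm f ^ 2)
    {Φ : Matrix (Fin d) (Fin d) ℂ →ₗ[ℂ] TensorMat (n + 1) d} (hΦ : IsQuantumChannel Φ) :
    performance a Φ ≤ (1 + μ) / (d + 1) := by
  obtain ⟨f, hf⟩ := hΦ.exists_isKrausFamily
  have hdR : (0 : ℝ) < d := by exact_mod_cast hd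
  have h : ∑ k, formS a (f k) ≤ μ * d := by
    rw [← hΦ.sum_l2norm_sq hf, Finset.mul_sum]
    exact Finset.sum_le_sum fun k _ => hμ (f k)
  rw [performance_eq hd ha hΦ, hf.sum_entanglementOverlap, div_le_div_iff₀ (by positivity)
    (by positivity)]
  nlinarith [mul_le_mul_of_nonneg_right h (by positivity : (0 : ℝ) ≤ d + 1)]

/-- All Choi vectors are of the form χ with the same weights b, hence share one Rayleigh quotient
whatever the permutation invariant vector is. Their squared norms add up to d, which cancels. -/
theorem performance_optCloner (hd : 1 ≤ d) {a b : Fin (n + 1) → ℝ} (ha : ∑ i, a i = 1)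
    (hb : gramForm n d b = 1) :
    performance a (optCloner d b)
      = (1 + ∑ i, a i * (∑ j, gram n d i j * b j) ^ 2) / (d + 1) := by
  have hdR : (0 : ℝ) < d := by exact_mod_cast hd
  have hT := symTrace_pos n hd
  have h : ∀ z : Fin n → Fin d, formS a (clonerKraus b z)
      = (∑ i, a i * (∑ j, gram n d i j * b j) ^ 2) * l2norm (clonerKraus b z) ^ 2 := by
    intro z
    have hz : clonerKraus b z
        = chiVec b (((√(d / symTrace n d) : ℝ) : ℂ) • symColumn z) := by
      simp only [clonerKraus, chiVec_eq, insertPair_smul, Finset.smul_sum]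
      exact Finset.sum_congr rfl fun i _ => smul_comm _ _ _
    have hp : IsPermInvariant (((√(d / symTrace n d) : ℝ) : ℂ) • symColumn z) := fun π y => by
      simp [isPermInvariant_symColumn z π y]
    rw [hz, formS_chiVec hp, l2norm_chiVec_sq hp, hb, one_mul]
  rw [performance_eq hd ha (isQuantumChannel_optCloner hd hb),
    (isKrausFamily_clonerKraus hd b).sum_entanglementOverlap]
  simp only [h, ← Finset.mul_sum, sum_l2norm_clonerKraus hd hb]
  field_simp

theorem IsTopEigenvector.gramForm_eq_one {a b : Fin (n + 1) → ℝ} {v : (Fin n → Fin d) → ℂ}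
    (h : IsTopEigenvector a b v) : gramForm n d b = 1 := by
  have h1 := gramForm_of_normalized (isPermInvariant_of_mem h.symmetric) h.unit b
  rw [h.normalized] at h1
  exact_mod_cast h1.symm

/-- Pairing the eigenvector equation with χ expresses the eigenvalue through b alone. This transfers
optimality from the given v to the columns used by the cloner. -/
theorem IsTopEigenvector.rayleigh {a b : Fin (n + 1) → ℝ} {v : (Fin n → Fin d) → ℂ}
    (h : IsTopEigenvector a b v) :
    ∑ i, a i * (∑ j, gram n d i j * b j) ^ 2 = maxEigenvalue (matS d a) := by
  have h1 := star_dotProduct_matS_mulVec a (chiVec b v)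
  rw [h.eigenvector, dotProduct_smul, h.normalized, smul_eq_mul, mul_one, Complex.ofReal_inj,
    formS_chiVec (isPermInvariant_of_mem h.symmetric)] at h1
  have h2 := h.unit
  rw [star_dotProduct_self, Complex.ofReal_eq_one] at h2
  rw [h1, h2, mul_one]

end Performance

end Cloning

theorem mainTheorem5 (n d : ℕ) (hd : 1 ≤ d) (a : Fin (n + 1) → ℝ)
    (ha : Cloning.IsDirectionVector a) :
    (∃ (b : Fin (n + 1) → ℝ) (v : (Fin n → Fin d) → ℂ),
      (∀ i, 0 ≤ b i) ∧ Cloning.IsTopEigenvector a b v) ∧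
    ∀ (b : Fin (n + 1) → ℝ) (v : (Fin n → Fin d) → ℂ), Cloning.IsTopEigenvector a b v →
      Cloning.IsQuantumChannel (Cloning.optCloner d b) ∧
      Cloning.performance a (Cloning.optCloner d b)
        = Cloning.maxEigenvalue (Cloning.matR d a) / (d + 1) ∧
      ∀ Ψ : Matrix (Fin d) (Fin d) ℂ →ₗ[ℂ] Cloning.TensorMat (n + 1) d,
        Cloning.IsQuantumChannel Ψ →
        Cloning.performance a Ψ ≤ Cloning.performance a (Cloning.optCloner d b) := by
  obtain ⟨μ, hgr, hμ, hex⟩ := Cloning.exists_isGreatest_eigenvalue_matS hd ha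
  refine ⟨hex, fun b v hbv => ?_⟩
  have hb := hbv.gramForm_eq_one
  have hperf : Cloning.performance a (Cloning.optCloner d b) = (1 + μ) / (d + 1) := by
    rw [Cloning.performance_optCloner hd ha.2 hb, hbv.rayleigh, Cloning.maxEigenvalue,
      hgr.csSup_eq]
  refine ⟨Cloning.isQuantumChannel_optCloner hd hb, ?_, fun Ψ hΨ => ?_⟩
  · rw [hperf, Cloning.maxEigenvalue_matR ha.2 hgr]
  · rw [hperf]
    exact Cloning.performance_le hd ha.2 hμ hΨ
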